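/- Theorem. For a real Banach space $Y$, a slice of a bounded set $A\subset Y$ is a non-empty set of the form $\{x\in A: f(x)>\sup_{a\in A} f(a)-\varepsilon\}$ with $f\in Y^*\setminus\{0\}$ and $\varepsilon>0$. A bounded set $A\subset Y$ is called slicely countably determined (SCD) if there is a sequence $(S_n)_{n\in\mathbb N}$ of slices of $A$ such that $A\subset\overline{\operatorname{conv}}(B)$ for every $B\subset Y$ that intersects all the $S_n$. The space $Y$ has the Daugavet property if $\|I+T\|=1+\|T\|$ for every bounded linear operator $T\colon Y\to Y$ of rank one. Let $Y\neq\{0\}$ be a real Banach space with the Daugavet property. Then there are convex, closed, bounded sets $B_1,B_2\subset Y$, symmetric in the sense that $-B_i=B_i$, which are SCD but whose union $B_1\cup B_2$ is not SCD. If, additionally, $Y$ is separable, then $B_1$ and $B_2$ can be chosen to have, moreover, non-empty interior, i.e. to be the closed unit balls of norms on $Y$ equivalent to the given one. -/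

import Mathlib

open scoped Pointwise

namespace BanachSCD

/-- `S` is a slice of `A`: a non-empty set of the form
`S(A, f, ε) = {x ∈ A : f x > sup_A f - ε}` with `f ≠ 0` a bounded linear functional and `ε > 0`.
(Only used for bounded `A`, for which the real supremum is the genuine one.) -/
def IsSlice {X : Type*} [NormedAddCommGroup X] [NormedSpace ℝ X] (A S : Set X) : Prop :=
  S.Nonempty ∧ ∃ f : X →L[ℝ] ℝ, f ≠ 0 ∧ ∃ ε : ℝ, 0 < ε ∧
    S = {x ∈ A | sSup (f '' A) - ε < f x}

/-- A sequence of non-empty subsets of `A` is determining for `A` if the closed convex hull of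
every set `B` that meets all of them contains `A`. -/
def IsDetermining {X : Type*} [NormedAddCommGroup X] [NormedSpace ℝ X]
    (A : Set X) (U : ℕ → Set X) : Prop :=
  (∀ n, (U n).Nonempty ∧ U n ⊆ A) ∧
    ∀ B : Set X, (∀ n, (B ∩ U n).Nonempty) → A ⊆ closure (convexHull ℝ B)

/-- Slicely countably determined sets. -/
def IsSCD {X : Type*} [NormedAddCommGroup X] [NormedSpace ℝ X] (A : Set X) : Prop :=
  Bornology.IsBounded A ∧ ∃ S : ℕ → Set X, (∀ n, IsSlice A (S n)) ∧ IsDetermining A S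

/-- The Daugavet property: every bounded rank-one operator satisfies the Daugavet equation. -/
def DaugavetProperty (X : Type*) [NormedAddCommGroup X] [NormedSpace ℝ X] : Prop :=
  ∀ T : X →L[ℝ] X, (T : X →ₗ[ℝ] X).rank = 1 →
    ‖ContinuousLinearMap.id ℝ X + T‖ = 1 + ‖T‖

/-- `B` is the closed unit ball of a norm on `X` that is equivalent to the given one.
(The lower bound makes the seminorm `p` a norm.) -/
def IsEquivNormUnitBall {X : Type*} [NormedAddCommGroup X] [NormedSpace ℝ X]
    (B : Set X) : Prop :=
  ∃ p : Seminorm ℝ X,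
    (∃ c C : ℝ, 0 < c ∧ 0 < C ∧ ∀ x, c * ‖x‖ ≤ p x ∧ p x ≤ C * ‖x‖) ∧ B = {x | p x ≤ 1}

end BanachSCD

namespace BanachSCD

/-! Let `f j` be functionals of norm at most one with a bounded biorthogonal sequence `e j`, adapted
to finite-dimensional spaces `G n` increasing in `n`. Let `R i` be the part of `⋃ G n` killed by all
`f j` with `j` of parity `i`. The body `B i` is the closed convex hull of a countable symmetric set:
points running densely through the unit sphere of `R i`, each tilted by a vanishing multiple of its
own `e j` with `j` of parity `i`, together with points `e j / 8 ± x n / 100`, which supply a ball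
around `0` when `x` is dense in the unit ball.

Each `B i` is SCD. The functional `f j` sees only the vertex tilted by `e j`, up to a small error,
so it helps to expose that vertex; slices at an exposed vertex shrink to it, and countably many such
slices determine the hull (`isSCD_closure_convexHull`).

The union is not SCD. By biorthogonality `e j` lies in `R (1 - i)`, and each `x n` splits into a
part in `R 0` and a part in `R 1`. So all vertices lie in the convex hull of the unit balls of `R 0`
and `R 1`, which the union contains (`exists_rich_ge`), and every slice of the union meets one of
these balls. The Daugavet property survives restriction to finitely many kernels
(`RelDaugavet.inf_ker`), so the slice contains points of that ball almost `ℓ₁`-orthogonal to any `G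
k`. Choosing one such point per slice, successively, gives a set whose closed span avoids a fixed
point of the union (`not_isSCD_of_almostL1Orth`).

The functionals themselves come from the weak-star Daugavet property of the dual, and `e` from
Helly's theorem. -/

/-- `y` is `ℓ₁`-orthogonal to `E` up to the factor `1 - ε`. -/
def AlmostL1Orth {A : Type*} [NormedAddCommGroup A] [NormedSpace ℝ A]
    (E : Submodule ℝ A) (ε : ℝ) (y : A) : Prop :=
  ∀ e ∈ E, ∀ t : ℝ, (1 - ε) * (‖e‖ + |t|) ≤ ‖e + t • y‖

/-- Every slice of the unit ball given by a functional in `Γ` contains a smaller one, all of whose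
points are almost `ℓ₁`-orthogonal to a prescribed unit vector. -/
def SliceDaugavet {A : Type*} [NormedAddCommGroup A] [NormedSpace ℝ A]
    (Γ : Submodule ℝ (StrongDual ℝ A)) : Prop :=
  ∀ x₀ : A, ‖x₀‖ = 1 → ∀ ε : ℝ, 0 < ε → ∀ h ∈ Γ, ∀ c : ℝ, (∃ x, ‖x‖ ≤ 1 ∧ c < h x) →
    ∃ h' ∈ Γ, ∃ c' : ℝ, (∃ x, ‖x‖ ≤ 1 ∧ c' < h' x) ∧
      ∀ y, ‖y‖ ≤ 1 → c' < h' y → c < h y ∧ 2 - ε ≤ ‖x₀ + y‖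

/-- Every slice of the unit ball of `K` given by a functional in `Γ` contains points that are
almost `ℓ₁`-orthogonal to a prescribed finite-dimensional subspace of the whole space. -/
def RelDaugavet {A : Type*} [NormedAddCommGroup A] [NormedSpace ℝ A]
    (Γ : Submodule ℝ (StrongDual ℝ A)) (K : Submodule ℝ A) : Prop :=
  ∀ h ∈ Γ, ∀ c : ℝ, (∃ x ∈ K, ‖x‖ ≤ 1 ∧ c < h x) →
    ∀ E : Submodule ℝ A, FiniteDimensional ℝ E → ∀ ε : ℝ, 0 < ε →
      ∃ y ∈ K, ‖y‖ ≤ 1 ∧ c < h y ∧ AlmostL1Orth E ε y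

/-! ### Almost `ℓ₁`-orthogonality to finite-dimensional subspaces. -/

section Orth

variable {A : Type*} [NormedAddCommGroup A] [NormedSpace ℝ A]

lemma AlmostL1Orth.mono {E E' : Submodule ℝ A} {ε ε' : ℝ} {y : A} (h : AlmostL1Orth E ε y)
    (hE : E' ≤ E) (hε : ε ≤ ε') : AlmostL1Orth E' ε' y := by
  intro e he t
  refine le_trans ?_ (h e (hE he) t)
  have : 0 ≤ ‖e‖ + |t| := by positivity
  nlinarith

lemma AlmostL1Orth.perturb {E : Submodule ℝ A} {ε η : ℝ} {y y' : A} (h : AlmostL1Orth E ε y)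
    (hy : ‖y - y'‖ ≤ η) : AlmostL1Orth E (ε + η) y' := by
  intro e he t
  have h1 := h e he t
  have h2 : e + t • y = (e + t • y') + t • (y - y') := by module
  have h3 : ‖e + t • y‖ ≤ ‖e + t • y'‖ + |t| * ‖y - y'‖ := by
    rw [h2]
    refine (norm_add_le _ _).trans ?_
    rw [norm_smul, Real.norm_eq_abs]
  have h4 : |t| * ‖y - y'‖ ≤ |t| * η := mul_le_mul_of_nonneg_left hy (abs_nonneg t)
  have h5 : 0 ≤ η * ‖e‖ := mul_nonneg ((norm_nonneg _).trans hy) (norm_nonneg _)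
  nlinarith

/-- Since `y₂` is also orthogonal to `y₁`, first `y₂` and then `y₁` can be split off; the loss is
`(1 - ε)² ≥ 1 - 2ε`. -/
lemma AlmostL1Orth.combo {E : Submodule ℝ A} {ε l : ℝ} {y₁ y₂ : A} (hε0 : 0 ≤ ε) (hε : ε ≤ 1)
    (hl0 : 0 ≤ l) (hl1 : l ≤ 1) (h₁ : AlmostL1Orth E ε y₁)
    (h₂ : AlmostL1Orth (E ⊔ Submodule.span ℝ {y₁}) ε y₂) :
    AlmostL1Orth E (2 * ε) (l • y₁ + (1 - l) • y₂) := by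
  intro e he t
  have hm : e + (t * l) • y₁ ∈ E ⊔ Submodule.span ℝ {y₁} :=
    Submodule.add_mem_sup he (Submodule.smul_mem _ _ (Submodule.mem_span_singleton_self _))
  have a1 := h₁ e he (t * l)
  have a2 := h₂ _ hm (t * (1 - l))
  have e1 : e + (t * l) • y₁ + (t * (1 - l)) • y₂ = e + t • (l • y₁ + (1 - l) • y₂) := by module
  rw [e1] at a2
  refine le_trans ?_ a2
  rw [abs_mul, abs_of_nonneg hl0] at a1
  rw [abs_mul, abs_of_nonneg (sub_nonneg.2 hl1)]
  have h6 : (1 - ε) * ((1 - ε) * (‖e‖ + |t| * l) + |t| * (1 - l)) ≤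
      (1 - ε) * (‖e + (t * l) • y₁‖ + |t| * (1 - l)) := by
    apply mul_le_mul_of_nonneg_left _ (by linarith)
    linarith
  refine le_trans ?_ h6
  have h7 : 0 ≤ |t| * (1 - l) := mul_nonneg (abs_nonneg _) (by linarith)
  have h8 : 0 ≤ ‖e‖ + |t| * l := by positivity
  nlinarith [mul_nonneg hε0 h7, mul_nonneg (mul_nonneg hε0 hε0) h8,
    mul_nonneg (sub_nonneg.2 hε) (mul_nonneg hε0 h7)]

/-- Scale `e + y` by the larger of `s` and `t` and subtract the surplus multiple of one of the two
vectors. -/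
lemma norm_add_smul_ge {ε t : ℝ} {e y : A} (he : ‖e‖ = 1) (hy : ‖y‖ ≤ 1)
    (h : 2 - ε ≤ ‖e + y‖) {s : ℝ} (hs : 0 ≤ s) (ht : 0 ≤ t) :
    (1 - ε) * (s + t) ≤ ‖s • e + t • y‖ := by
  have hε : 0 ≤ ε := by
    have := norm_add_le e y
    linarith
  rcases le_total t s with hts | hts
  · have h1 : s • (e + y) = (s • e + t • y) + (s - t) • y := by module
    have h2 : s * ‖e + y‖ ≤ ‖s • e + t • y‖ + (s - t) * ‖y‖ := by
      have := norm_add_le (s • e + t • y) ((s - t) • y)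
      rwa [← h1, norm_smul, norm_smul, Real.norm_of_nonneg hs,
        Real.norm_of_nonneg (sub_nonneg.2 hts)] at this
    have h3 : (s - t) * ‖y‖ ≤ (s - t) * 1 := mul_le_mul_of_nonneg_left hy (by linarith)
    nlinarith [mul_le_mul_of_nonneg_left h hs, mul_nonneg hε ht]
  · have h1 : t • (e + y) = (s • e + t • y) + (t - s) • e := by module
    have h2 : t * ‖e + y‖ ≤ ‖s • e + t • y‖ + (t - s) * ‖e‖ := by
      have := norm_add_le (s • e + t • y) ((t - s) • e)
      rwa [← h1, norm_smul, norm_smul, Real.norm_of_nonneg ht,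
        Real.norm_of_nonneg (sub_nonneg.2 hts)] at this
    nlinarith [mul_le_mul_of_nonneg_left h ht, mul_nonneg hε hs]

/-- The unit vector `u` serves only the case `e = 0`, where a lower bound for `‖y‖` is required. -/
lemma almostL1Orth_of_unit {E : Submodule ℝ A} {ε : ℝ} {y u : A} (hu : u ∈ E) (hu1 : ‖u‖ = 1)
    (hy : ‖y‖ ≤ 1) (h : ∀ e ∈ E, ‖e‖ = 1 → 2 - ε ≤ ‖e + y‖) : AlmostL1Orth E ε y := by
  have key : ∀ e ∈ E, ∀ t : ℝ, 0 ≤ t → (1 - ε) * (‖e‖ + t) ≤ ‖e + t • y‖ := by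
    intro e he t ht
    by_cases h0 : e = 0
    · subst h0
      have := norm_add_smul_ge hu1 hy (h u hu hu1) le_rfl ht
      simpa using this
    · have hn : ‖e‖ ≠ 0 := norm_ne_zero_iff.2 h0
      have h1 : ‖(‖e‖⁻¹ • e)‖ = 1 := by
        rw [norm_smul, norm_inv, norm_norm, inv_mul_cancel₀ hn]
      have := norm_add_smul_ge h1 hy (h _ (E.smul_mem _ he) h1) (norm_nonneg e) ht
      rwa [smul_smul, mul_inv_cancel₀ hn, one_smul] at this
  intro e he t
  rcases le_total 0 t with ht | ht
  · rw [abs_of_nonneg ht]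
    exact key e he t ht
  · rw [abs_of_nonpos ht]
    have := key (-e) (E.neg_mem he) (-t) (by linarith)
    rwa [norm_neg, neg_smul, ← neg_add, norm_neg] at this

lemma exists_finite_net {E : Submodule ℝ A} [FiniteDimensional ℝ E] {u : A} (hu : u ∈ E)
    (hu1 : ‖u‖ = 1) {ε : ℝ} (hε : 0 < ε) :
    ∃ N : Set A, N.Finite ∧ (∀ x ∈ N, ‖x‖ = 1) ∧
      ∀ y, ‖y‖ ≤ 1 → (∀ x ∈ N, 2 - ε ≤ ‖x + y‖) → AlmostL1Orth E (2 * ε) y := by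
  have hcomp : IsCompact ((E : Set A) ∩ Metric.sphere 0 1) := by
    have : IsCompact ((fun x : E => (x : A)) '' Metric.sphere (0 : E) 1) :=
      (isCompact_sphere (0 : E) 1).image continuous_subtype_val
    convert this using 1
    ext x
    simp
    tauto
  obtain ⟨N, hNs, hNf, hN⟩ := hcomp.finite_cover_balls hε
  refine ⟨N, hNf, fun x hx => by simpa using (hNs hx).2, fun y hy h => ?_⟩
  refine almostL1Orth_of_unit hu hu1 hy fun e he he1 => ?_
  have : e ∈ ⋃ x ∈ N, Metric.ball x ε := hN ⟨he, by simpa using he1⟩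
  simp only [Set.mem_iUnion, Metric.mem_ball, exists_prop] at this
  obtain ⟨x, hx, hd⟩ := this
  have h1 := h x hx
  have h2 : x + y = (e + y) - (e - x) := by abel
  have h3 : ‖x + y‖ ≤ ‖e + y‖ + ‖e - x‖ := by
    rw [h2]
    exact norm_sub_le _ _
  rw [dist_eq_norm] at hd
  linarith

/-- The property yields a whole subslice rather than one point, so the vectors of `N` can be treated
one after another in nested slices. -/
lemma SliceDaugavet.finite {Γ : Submodule ℝ (StrongDual ℝ A)} (hΓ : SliceDaugavet Γ)
    {N : Set A} (hN : N.Finite) (hN1 : ∀ x ∈ N, ‖x‖ = 1) {ε : ℝ} (hε : 0 < ε) :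
    ∀ h ∈ Γ, ∀ c : ℝ, (∃ x, ‖x‖ ≤ 1 ∧ c < h x) →
    ∃ h' ∈ Γ, ∃ c' : ℝ, (∃ x, ‖x‖ ≤ 1 ∧ c' < h' x) ∧
      ∀ y, ‖y‖ ≤ 1 → c' < h' y → c < h y ∧ ∀ x ∈ N, 2 - ε ≤ ‖x + y‖ := by
  induction N, hN using Set.Finite.induction_on with
  | empty => exact fun h hh c hc => ⟨h, hh, c, hc, fun y _ hy' => ⟨hy', by simp⟩⟩
  | @insert a s _ _ ih =>
    intro h hh c hc
    obtain ⟨h₁, hh₁, c₁, hc₁, H₁⟩ := ih (fun x hx => hN1 x (Set.mem_insert_of_mem _ hx)) h hh c hc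
    obtain ⟨h₂, hh₂, c₂, hc₂, H₂⟩ := hΓ a (hN1 a (Set.mem_insert _ _)) ε hε h₁ hh₁ c₁ hc₁
    refine ⟨h₂, hh₂, c₂, hc₂, fun y hy hy' => ?_⟩
    obtain ⟨a1, a2⟩ := H₂ y hy hy'
    obtain ⟨b1, b2⟩ := H₁ y hy a1
    refine ⟨b1, fun x hx => ?_⟩
    rcases hx with rfl | hx
    · exact a2
    · exact b2 x hx

lemma SliceDaugavet.relDaugavet_top [Nontrivial A] {Γ : Submodule ℝ (StrongDual ℝ A)}
    (hΓ : SliceDaugavet Γ) : RelDaugavet Γ ⊤ := by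
  rintro h hh c ⟨x, -, hx1, hcx⟩ E hE ε hε
  obtain ⟨u, hu⟩ := exists_norm_eq A zero_le_one
  have hu' : u ∈ E ⊔ Submodule.span ℝ {u} :=
    Submodule.mem_sup_right (Submodule.mem_span_singleton_self u)
  obtain ⟨N, hNf, hN1, hN⟩ := exists_finite_net hu' hu (half_pos hε)
  obtain ⟨h', -, c', ⟨y, hy1, hy2⟩, H⟩ := hΓ.finite hNf hN1 (half_pos hε) h hh c ⟨x, hx1, hcx⟩
  obtain ⟨a1, a2⟩ := H y hy1 hy2
  exact ⟨y, trivial, hy1, a1, (hN y hy1 a2).mono le_sup_left (by linarith)⟩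

end Orth

end BanachSCD
namespace BanachSCD

/-! ### Passing to the kernels of finitely many functionals. -/

section Rel

variable {A : Type*} [NormedAddCommGroup A] [NormedSpace ℝ A]

/-- Let `g` be a norm-preserving extension of `h` from `K ⊓ φ.ker`. Then `h - g` vanishes on that
kernel, hence is a multiple of `φ` on `K`, and `M = ‖g‖`. -/
lemma exists_sub_smul_bound (K : Submodule ℝ A) (h φ : StrongDual ℝ A) {a : A} (ha : a ∈ K)
    (hφa : φ a = 1) :
    ∃ s M : ℝ, 0 ≤ M ∧ (∀ x ∈ K, |h x - s * φ x| ≤ M * ‖x‖) ∧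
      ∀ η : ℝ, 0 < η → ∃ x ∈ K ⊓ φ.ker, ‖x‖ ≤ 1 ∧ M - η < h x := by
  set K' : Submodule ℝ A := K ⊓ φ.ker with hK'
  obtain ⟨g, hg, hgn⟩ := exists_extension_norm_eq K' (h.comp K'.subtypeL)
  have hg' : ∀ x ∈ K', g x = h x := fun x hx => hg ⟨x, hx⟩
  refine ⟨h a - g a, ‖g‖, norm_nonneg _, fun x hx => ?_, fun η hη => ?_⟩
  · have hm : x - φ x • a ∈ K' := by
      refine ⟨K.sub_mem hx (K.smul_mem _ ha), ?_⟩
      simp [hφa]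
    have h1 := hg' _ hm
    simp only [map_sub, map_smul, smul_eq_mul] at h1
    have h2 : h x - (h a - g a) * φ x = g x := by linarith
    rw [h2]
    exact g.le_opNorm x
  · by_cases h0 : ‖g‖ - η < 0
    · exact ⟨0, K'.zero_mem, by simp, by simpa using h0⟩
    · have hlt : ‖g‖ - η < ‖h.comp K'.subtypeL‖ := by
        rw [← hgn]
        linarith
      obtain ⟨x, hx1, hx2⟩ := ContinuousLinearMap.exists_lt_apply_of_lt_opNorm _ hlt
      have hx2' : ‖g‖ - η < |h x| := hx2
      rcases le_total 0 (h x) with hs | hs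
      · exact ⟨x, x.2, hx1.le, by rwa [abs_of_nonneg hs] at hx2'⟩
      · refine ⟨-x, K'.neg_mem x.2, by simpa using hx1.le, ?_⟩
        rw [abs_of_nonpos hs] at hx2'
        simpa using hx2'

lemma exists_convex_comb_small {p q δ : ℝ} (hδ : 0 < δ) (hp : -δ < p) (hq : q < δ) :
    ∃ l : ℝ, 0 ≤ l ∧ l ≤ 1 ∧ |l * p + (1 - l) * q| ≤ δ := by
  by_cases h1 : p ≤ δ
  · exact ⟨1, by norm_num, le_rfl, by simpa using abs_le.2 ⟨hp.le, h1⟩⟩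
  by_cases h2 : -δ ≤ q
  · exact ⟨0, le_rfl, by norm_num, by simpa using abs_le.2 ⟨h2, hq.le⟩⟩
  push Not at h1 h2
  have h3 : 0 < p - q := by linarith
  refine ⟨-q / (p - q), div_nonneg (by linarith) h3.le, (div_le_one h3).2 (by linarith), ?_⟩
  have : -q / (p - q) * p + (1 - -q / (p - q)) * q = 0 := by
    field_simp
    ring
  rw [this, abs_zero]
  exact hδ.le

/-- Modulo `φ`, replace `h` by `g` whose norm `M` on `K` is already approached on the kernel. The
slices of `g + δφ` and `g - δφ` at level `M - δ²` contain kernel points and force `φ > -δ` and `φ <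
δ` respectively, with `g` still close to `M`. Choosing the second point orthogonal also to the
first, some convex combination of the two is orthogonal to `E` with `|φ| ≤ δ`; a small correction
along `a` and a rescaling put it in the unit ball of the kernel. -/
lemma RelDaugavet.inf_ker {Γ : Submodule ℝ (StrongDual ℝ A)} {K : Submodule ℝ A}
    (hK : RelDaugavet Γ K) {φ : StrongDual ℝ A} (hφ : φ ∈ Γ) : RelDaugavet Γ (K ⊓ φ.ker) := by
  by_cases hker : ∀ x ∈ K, φ x = 0
  · have : K ⊓ φ.ker = K := inf_eq_left.2 fun x hx => by simpa using hker x hx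
    rwa [this]
  push Not at hker
  obtain ⟨a₀, ha₀, hφ₀⟩ := hker
  obtain ⟨a, ha, hφa⟩ : ∃ a ∈ K, φ a = 1 :=
    ⟨(φ a₀)⁻¹ • a₀, K.smul_mem _ ha₀, by simp [hφ₀]⟩
  rintro h hh c ⟨x, hxK, hx1, hxc⟩ E hE ε hε
  obtain ⟨s, M, hM0, hM, hMx⟩ := exists_sub_smul_bound K h φ ha hφa
  set g : StrongDual ℝ A := h - s • φ with hg
  have hgΓ : g ∈ Γ := Γ.sub_mem hh (Γ.smul_mem _ hφ)
  have hgx : ∀ y, g y = h y - s * φ y := fun y => by simp [hg]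
  have hgM : ∀ y ∈ K, |g y| ≤ M * ‖y‖ := fun y hy => by rw [hgx]; exact hM y hy
  have hgM1 : ∀ y ∈ K, ‖y‖ ≤ 1 → g y ≤ M := fun y hy hy1 =>
    (le_abs_self _).trans ((hgM y hy).trans (mul_le_of_le_one_right hM0 hy1))
  have hcM : c < M := by
    refine hxc.trans_le ?_
    have h1 := hgM1 x hxK.1 hx1
    rw [hgx, show φ x = 0 from hxK.2] at h1
    simpa using h1
  set P : ℝ := ‖φ‖ with hP
  have hP0 : 0 ≤ P := norm_nonneg _
  set Q : ℝ := ‖a‖ + 1 with hQ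
  have hQ0 : 0 < Q := by positivity
  set R : ℝ := 1 + P + 2 * M * Q with hR
  have hR0 : 0 < R := by positivity
  -- `R` collects all losses in the value of `h`, and `4 * Q` those in orthogonality, from
  -- projecting along `a` and rescaling.
  obtain ⟨δ, hδ0, hδ1, hδR, hδε⟩ : ∃ δ : ℝ, 0 < δ ∧ δ ≤ 1 ∧ δ * R ≤ M - c ∧ δ * (4 * Q) ≤ ε := by
    refine ⟨min 1 (min ((M - c) / R) (ε / (4 * Q))), ?_, min_le_left _ _, ?_, ?_⟩
    · refine lt_min one_pos (lt_min (div_pos (by linarith) hR0) (by positivity))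
    · rw [← le_div_iff₀ hR0]
      exact (min_le_right _ _).trans (min_le_left _ _)
    · rw [← le_div_iff₀ (by positivity)]
      exact (min_le_right _ _).trans (min_le_right _ _)
  have hφP : ∀ y, ‖y‖ ≤ 1 → |φ y| ≤ P := fun y hy =>
    (φ.le_opNorm y).trans (mul_le_of_le_one_right hP0 hy)
  obtain ⟨z, hzK, hz1, hz⟩ := hMx (δ ^ 2) (by positivity)
  have hzφ : φ z = 0 := hzK.2
  set e₀ : ℝ := min ε 1 / 4 with he₀
  have he₀0 : 0 < e₀ := by positivity
  have he₀1 : e₀ ≤ 1 := by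
    have := min_le_right ε 1
    linarith
  have he₀ε : 2 * e₀ ≤ ε / 2 := by
    have := min_le_left ε 1
    linarith
  obtain ⟨y₁, hy₁K, hy₁1, hy₁, hy₁O⟩ := hK (g + δ • φ) (Γ.add_mem hgΓ (Γ.smul_mem _ hφ))
    (M - δ ^ 2) ⟨z, hzK.1, hz1, by simpa [hgx, hzφ] using hz⟩ E hE e₀ he₀0
  obtain ⟨y₂, hy₂K, hy₂1, hy₂, hy₂O⟩ := hK (g - δ • φ) (Γ.sub_mem hgΓ (Γ.smul_mem _ hφ))
    (M - δ ^ 2) ⟨z, hzK.1, hz1, by simpa [hgx, hzφ] using hz⟩ (E ⊔ Submodule.span ℝ {y₁})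
    inferInstance e₀ he₀0
  simp only [add_apply, sub_apply,
    smul_apply, smul_eq_mul] at hy₁ hy₂
  have g1 := hgM1 y₁ hy₁K hy₁1
  have g2 := hgM1 y₂ hy₂K hy₂1
  have p1 := abs_le.1 (hφP y₁ hy₁1)
  have p2 := abs_le.1 (hφP y₂ hy₂1)
  have hp : -δ < φ y₁ := by
    by_contra hcon
    push Not at hcon
    have := mul_le_mul_of_nonneg_left hcon hδ0.le
    linarith [sq δ]
  have hq : φ y₂ < δ := by
    by_contra hcon
    push Not at hcon
    have := mul_le_mul_of_nonneg_left hcon hδ0.le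
    linarith [sq δ]
  have k1 : M - δ ^ 2 - δ * P < g y₁ := by
    linarith [mul_le_mul_of_nonneg_left p1.2 hδ0.le]
  have k2 : M - δ ^ 2 - δ * P < g y₂ := by
    linarith [mul_le_mul_of_nonneg_left p2.1 hδ0.le]
  obtain ⟨l, hl0, hl1, hl⟩ := exists_convex_comb_small hδ0 hp hq
  set y : A := l • y₁ + (1 - l) • y₂ with hy
  have hyK : y ∈ K := K.add_mem (K.smul_mem _ hy₁K) (K.smul_mem _ hy₂K)
  have hyO : AlmostL1Orth E (ε / 2) y :=
    (AlmostL1Orth.combo he₀0.le he₀1 hl0 hl1 hy₁O hy₂O).mono le_rfl he₀ε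
  have hyφ : |φ y| ≤ δ := by simpa [hy] using hl
  have hyg : M - δ ^ 2 - δ * P < g y := by
    have : g y = l * g y₁ + (1 - l) * g y₂ := by simp [hy]
    rw [this]
    rcases hl0.eq_or_lt with rfl | hl0'
    · simpa using k2
    · linarith [mul_lt_mul_of_pos_left k1 hl0', mul_le_mul_of_nonneg_left k2.le (sub_nonneg.2 hl1)]
  have hy1 : ‖y‖ ≤ 1 := by
    refine (norm_add_le _ _).trans ?_
    rw [norm_smul, norm_smul, Real.norm_of_nonneg hl0, Real.norm_of_nonneg (sub_nonneg.2 hl1)]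
    linarith [mul_le_mul_of_nonneg_left hy₁1 hl0,
      mul_le_mul_of_nonneg_left hy₂1 (sub_nonneg.2 hl1)]
  set y' : A := y - φ y • a with hy'
  have hy'K : y' ∈ K ⊓ φ.ker := by
    refine ⟨K.sub_mem hyK (K.smul_mem _ ha), ?_⟩
    simp [hy', hφa]
  have hd1 : ‖y - y'‖ ≤ δ * Q := by
    rw [hy', sub_sub_cancel, norm_smul, Real.norm_eq_abs]
    exact mul_le_mul hyφ (by linarith) (norm_nonneg _) hδ0.le
  have hy'n : ‖y'‖ ≤ 1 + δ * Q := by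
    have := norm_sub_norm_le y' y
    have h3 := norm_sub_rev y' y
    linarith
  have hT : 0 < 1 + δ * Q := by positivity
  set y'' : A := (1 + δ * Q)⁻¹ • y' with hy''
  have hd2 : ‖y' - y''‖ ≤ δ * Q := by
    have : y' - y'' = (δ * Q * (1 + δ * Q)⁻¹) • y' := by
      have h4 : δ * Q * (1 + δ * Q)⁻¹ = 1 - (1 + δ * Q)⁻¹ := by
        field_simp
        ring
      rw [hy'', h4, sub_smul, one_smul]
    rw [this, norm_smul, Real.norm_of_nonneg (by positivity)]
    calc δ * Q * (1 + δ * Q)⁻¹ * ‖y'‖ ≤ δ * Q * (1 + δ * Q)⁻¹ * (1 + δ * Q) :=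
          mul_le_mul_of_nonneg_left hy'n (by positivity)
      _ = δ * Q := by field_simp
  have hd : ‖y - y''‖ ≤ 2 * (δ * Q) := by
    have := norm_sub_le_norm_sub_add_norm_sub y y' y''
    linarith
  have hy''K : y'' ∈ K ⊓ φ.ker := Submodule.smul_mem _ _ hy'K
  refine ⟨y'', hy''K, ?_, ?_, (hyO.perturb hd).mono le_rfl (by linarith)⟩
  · rw [hy'', norm_smul, Real.norm_of_nonneg (by positivity), inv_mul_le_iff₀ hT]
    linarith
  · have e1 : h y'' = g y'' := by rw [hgx, show φ y'' = 0 from hy''K.2]; ring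
    have e2 := (le_abs_self _).trans (hgM (y - y'') (K.sub_mem hyK hy''K.1))
    rw [map_sub] at e2
    have e3 : M * ‖y - y''‖ ≤ M * (2 * (δ * Q)) := mul_le_mul_of_nonneg_left hd hM0
    have e4 : δ * R = δ + δ * P + 2 * M * Q * δ := by rw [hR]; ring
    have e5 : δ ^ 2 ≤ δ := by
      rw [sq]
      exact mul_le_of_le_one_left hδ0.le hδ1
    rw [e1]
    linarith

lemma RelDaugavet.iInf_ker {Γ : Submodule ℝ (StrongDual ℝ A)} (hΓ : RelDaugavet Γ ⊤)
    {ι : Type*} (s : Finset ι) (φ : ι → StrongDual ℝ A) (hφ : ∀ i ∈ s, φ i ∈ Γ) :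
    ∃ K : Submodule ℝ A, (∀ x, x ∈ K ↔ ∀ i ∈ s, φ i x = 0) ∧ RelDaugavet Γ K := by
  classical
  induction s using Finset.induction_on with
  | empty => exact ⟨⊤, by simp, hΓ⟩
  | insert i s _ ih =>
    obtain ⟨K, hK, hKD⟩ := ih fun j hj => hφ j (Finset.mem_insert_of_mem hj)
    refine ⟨K ⊓ (φ i).ker, fun x => ?_, hKD.inf_ker (hφ i (Finset.mem_insert_self _ _))⟩
    simp [hK, and_comm]

end Rel

/-! ### From the Daugavet equation to slices of the ball and weak-star slices of the dual ball. -/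

section Daugavet

variable {Y : Type*} [NormedAddCommGroup Y] [NormedSpace ℝ Y]

lemma DaugavetProperty.exists_norm_add_gt (hY : DaugavetProperty Y) {h : StrongDual ℝ Y}
    (hh : ‖h‖ = 1) {x₀ : Y} (hx₀ : ‖x₀‖ = 1) {ε : ℝ} (hε : 0 < ε) :
    ∃ z, ‖z‖ ≤ 1 ∧ 2 - ε < ‖z + h z • x₀‖ := by
  have hx0 : x₀ ≠ 0 := by
    rintro rfl
    simp at hx₀
  have hh0 : h ≠ 0 := by
    rintro rfl
    simp at hh
  set T : Y →L[ℝ] Y := h.smulRight x₀ with hT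
  have hrank : (T : Y →ₗ[ℝ] Y).rank = 1 := by
    obtain ⟨a, ha⟩ : ∃ a, h a ≠ 0 := by
      by_contra hcon
      push Not at hcon
      exact hh0 (ContinuousLinearMap.ext hcon)
    have hr : (T : Y →ₗ[ℝ] Y).range = Submodule.span ℝ {x₀} := by
      ext y
      simp only [LinearMap.mem_range, Submodule.mem_span_singleton]
      constructor
      · rintro ⟨b, rfl⟩
        exact ⟨h b, rfl⟩
      · rintro ⟨r, rfl⟩
        refine ⟨(r / h a) • a, ?_⟩
        simp [hT, smul_smul, ha]
    rw [LinearMap.rank, hr, rank_submodule_eq_one_iff]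
    exact ⟨x₀, Submodule.mem_span_singleton_self _, hx0, le_rfl⟩
  have hn : ‖ContinuousLinearMap.id ℝ Y + T‖ = 2 := by
    rw [hY T hrank, hT, ContinuousLinearMap.norm_smulRight_apply, hh, hx₀]
    norm_num
  have hlt : 2 - ε < ‖ContinuousLinearMap.id ℝ Y + T‖ := by
    rw [hn]
    linarith
  obtain ⟨z, hz1, hz⟩ := ContinuousLinearMap.exists_lt_apply_of_lt_opNorm _ hlt
  exact ⟨z, hz1.le, by simpa [hT] using hz⟩

lemma abs_apply_le_one {h : StrongDual ℝ Y} (hh : ‖h‖ ≤ 1) {y : Y} (hy : ‖y‖ ≤ 1) : |h y| ≤ 1 := by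
  have := h.le_opNorm y
  rw [Real.norm_eq_abs] at this
  nlinarith [norm_nonneg h, norm_nonneg y]

/-- Let `f` norm the nearly extremal vector `z + h z • x₀`. On the unit ball both summands of `f + f
x₀ • h` are at most one, so a value above `2 - η` makes `f y`, `h y` and `f x₀` all exceed `1 - η`;
then `f` witnesses that `‖x₀ + y‖` is large. -/
lemma DaugavetProperty.sliceDaugavet [Nontrivial Y] (hY : DaugavetProperty Y) :
    SliceDaugavet (⊤ : Submodule ℝ (StrongDual ℝ Y)) := by
  intro x₀ hx₀ ε hε
  have key : ∀ h : StrongDual ℝ Y, ‖h‖ = 1 → ∀ c : ℝ, c < 1 →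
      ∃ h' ∈ (⊤ : Submodule ℝ (StrongDual ℝ Y)), ∃ c' : ℝ, (∃ x, ‖x‖ ≤ 1 ∧ c' < h' x) ∧
      ∀ y, ‖y‖ ≤ 1 → c' < h' y → c < h y ∧ 2 - ε ≤ ‖x₀ + y‖ := by
    intro h hh c hc
    set η : ℝ := min (min (ε / 2) (1 - c)) 1 with hη
    have hη0 : 0 < η := lt_min (lt_min (by linarith) (by linarith)) one_pos
    have hη1 : η ≤ 1 := min_le_right _ _
    have hη2 : η ≤ ε / 2 := (min_le_left _ _).trans (min_le_left _ _)
    have hη3 : η ≤ 1 - c := (min_le_left _ _).trans (min_le_right _ _)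
    obtain ⟨z, hz1, hz⟩ := hY.exists_norm_add_gt hh hx₀ hη0
    obtain ⟨f, hf1, hfz⟩ := exists_dual_vector'' ℝ (z + h z • x₀)
    obtain ⟨f, z, hf1, hz1, hf0, hfz⟩ : ∃ (f : StrongDual ℝ Y) (z : Y), ‖f‖ ≤ 1 ∧ ‖z‖ ≤ 1 ∧
        0 ≤ f x₀ ∧ 2 - η < f z + h z * f x₀ := by
      simp only [map_add, map_smul, smul_eq_mul, RCLike.ofReal_real_eq_id, id_eq] at hfz
      rcases le_total 0 (f x₀) with h0 | h0
      · exact ⟨f, z, hf1, hz1, h0, by rw [hfz]; exact hz⟩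
      · refine ⟨-f, -z, by simpa using hf1, by simpa using hz1, by simpa using h0, ?_⟩
        simp only [map_neg, neg_apply]
        nlinarith
    refine ⟨f + f x₀ • h, trivial, 2 - η, ⟨z, hz1, by simpa [mul_comm] using hfz⟩,
      fun y hy1 hy => ?_⟩
    simp only [add_apply, smul_apply, smul_eq_mul] at hy
    have a1 := abs_le.1 (abs_apply_le_one hf1 hy1)
    have a2 := abs_le.1 (abs_apply_le_one hf1 hx₀.le)
    have a3 := abs_le.1 (abs_apply_le_one hh.le hy1)
    have b1 : f x₀ * h y ≤ 1 := by nlinarith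
    have b2 : 1 - η < f x₀ * h y := by linarith
    have b3 : 0 < h y := by
      by_contra hcon
      push Not at hcon
      nlinarith
    have b4 : 1 - η < h y := by nlinarith
    have b5 : 1 - η < f x₀ := by nlinarith
    refine ⟨by linarith, ?_⟩
    have c1 : f (x₀ + y) ≤ ‖x₀ + y‖ := by
      have := f.le_of_opNorm_le hf1 (x₀ + y)
      rw [one_mul] at this
      exact (le_abs_self _).trans this
    rw [map_add] at c1
    linarith
  rintro h - c ⟨x, hx1, hx⟩
  by_cases h0 : h = 0
  · obtain ⟨h₁, hh₁, -⟩ := exists_dual_vector' ℝ x₀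
    obtain ⟨h', hh', c', hne, H⟩ := key h₁ hh₁ 0 one_pos
    refine ⟨h', hh', c', hne, fun y hy hy' => ⟨?_, (H y hy hy').2⟩⟩
    simpa [h0] using hx
  · have hn : 0 < ‖h‖ := norm_pos_iff.2 h0
    have h1 : ‖‖h‖⁻¹ • h‖ = 1 := by
      rw [norm_smul, norm_inv, norm_norm, inv_mul_cancel₀ hn.ne']
    have h2 : ‖h‖⁻¹ * c < 1 := by
      rw [inv_mul_lt_iff₀ hn, mul_one]
      exact hx.trans_le ((le_abs_self _).trans ((h.le_opNorm x).trans
        (mul_le_of_le_one_right hn.le hx1)))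
    obtain ⟨h', hh', c', hne, H⟩ := key _ h1 _ h2
    refine ⟨h', hh', c', hne, fun y hy hy' => ⟨?_, (H y hy hy').2⟩⟩
    have := (H y hy hy').1
    simpa [hn] using this

/-- The same argument with points and functionals exchanged: the smaller slice is given by
evaluation at `z + f₀ z • x`, so it is again weak-star. -/
lemma DaugavetProperty.sliceDaugavet_dual [Nontrivial Y] (hY : DaugavetProperty Y) :
    SliceDaugavet (NormedSpace.inclusionInDoubleDual ℝ Y).range := by
  intro f₀ hf₀ ε hε
  have key : ∀ x : Y, ‖x‖ = 1 → ∀ c : ℝ, c < 1 →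
      ∃ h' ∈ (NormedSpace.inclusionInDoubleDual ℝ Y).range, ∃ c' : ℝ,
      (∃ g, ‖g‖ ≤ 1 ∧ c' < h' g) ∧
      ∀ g, ‖g‖ ≤ 1 → c' < h' g → c < g x ∧ 2 - ε ≤ ‖f₀ + g‖ := by
    intro x hx c hc
    set η : ℝ := min (min (ε / 2) (1 - c)) 1 with hη
    have hη0 : 0 < η := lt_min (lt_min (by linarith) (by linarith)) one_pos
    have hη1 : η ≤ 1 := min_le_right _ _
    have hη2 : η ≤ ε / 2 := (min_le_left _ _).trans (min_le_left _ _)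
    have hη3 : η ≤ 1 - c := (min_le_left _ _).trans (min_le_right _ _)
    obtain ⟨z, hz1, hz0, hz⟩ : ∃ z, ‖z‖ ≤ 1 ∧ 0 ≤ f₀ z ∧ 2 - η < ‖z + f₀ z • x‖ := by
      obtain ⟨z, hz1, hz⟩ := hY.exists_norm_add_gt hf₀ hx hη0
      rcases le_total 0 (f₀ z) with h0 | h0
      · exact ⟨z, hz1, h0, hz⟩
      · refine ⟨-z, by simpa using hz1, by simpa using h0, ?_⟩
        rwa [map_neg, neg_smul, ← neg_add, norm_neg]
    obtain ⟨g, hg1, hgz⟩ := exists_dual_vector'' ℝ (z + f₀ z • x)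
    refine ⟨NormedSpace.inclusionInDoubleDual ℝ Y (z + f₀ z • x), ⟨_, rfl⟩, 2 - η,
      ⟨g, hg1, ?_⟩, fun g hg1 hg => ?_⟩
    · rw [NormedSpace.dual_def, hgz]
      exact hz
    · rw [NormedSpace.dual_def, map_add, map_smul, smul_eq_mul] at hg
      have a1 := abs_le.1 (abs_apply_le_one hg1 hz1)
      have a2 := abs_le.1 (abs_apply_le_one hg1 hx.le)
      have a3 := abs_le.1 (abs_apply_le_one hf₀.le hz1)
      have b1 : f₀ z * g x ≤ 1 := by nlinarith
      have b2 : 1 - η < f₀ z * g x := by linarith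
      have b3 : 0 < g x := by
        by_contra hcon
        push Not at hcon
        nlinarith
      have b4 : 1 - η < g x := by nlinarith
      have b5 : 1 - η < f₀ z := by nlinarith
      refine ⟨by linarith, ?_⟩
      have c1 : (f₀ + g) z ≤ ‖f₀ + g‖ :=
        (le_abs_self _).trans (((f₀ + g).le_opNorm z).trans
          (mul_le_of_le_one_right (norm_nonneg _) hz1))
      rw [add_apply] at c1
      linarith
  rintro - ⟨x, rfl⟩ c ⟨g, hg1, hg⟩
  simp only [ContinuousLinearMap.coe_coe, NormedSpace.dual_def] at hg ⊢
  by_cases h0 : x = 0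
  · obtain ⟨x₁, hx₁⟩ := exists_norm_eq Y zero_le_one
    obtain ⟨h', hh', c', hne, H⟩ := key x₁ hx₁ 0 one_pos
    refine ⟨h', hh', c', hne, fun y hy hy' => ⟨?_, (H y hy hy').2⟩⟩
    simpa [h0] using hg
  · have hn : 0 < ‖x‖ := norm_pos_iff.2 h0
    have h1 : ‖‖x‖⁻¹ • x‖ = 1 := by
      rw [norm_smul, norm_inv, norm_norm, inv_mul_cancel₀ hn.ne']
    have h2 : ‖x‖⁻¹ * c < 1 := by
      rw [inv_mul_lt_iff₀ hn, mul_one]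
      refine hg.trans_le ((le_abs_self _).trans ((g.le_opNorm x).trans ?_))
      nlinarith
    obtain ⟨h', hh', c', hne, H⟩ := key _ h1 _ h2
    refine ⟨h', hh', c', hne, fun y hy hy' => ⟨?_, (H y hy hy').2⟩⟩
    have := (H y hy hy').1
    simpa [hn] using this

lemma DaugavetProperty.relDaugavet [Nontrivial Y] (hY : DaugavetProperty Y) :
    RelDaugavet (⊤ : Submodule ℝ (StrongDual ℝ Y)) ⊤ :=
  hY.sliceDaugavet.relDaugavet_top

lemma DaugavetProperty.relDaugavet_dual [Nontrivial Y] (hY : DaugavetProperty Y) :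
    RelDaugavet (NormedSpace.inclusionInDoubleDual ℝ Y).range ⊤ :=
  hY.sliceDaugavet_dual.relDaugavet_top

end Daugavet

end BanachSCD
namespace BanachSCD

/-! ### Finite approximation of balls, and Helly's theorem. -/

section Finite

variable {Y : Type*} [NormedAddCommGroup Y] [NormedSpace ℝ Y]

lemma exists_le_of_mem_convexHull {T : Set Y} {x : Y} (hx : x ∈ convexHull ℝ T)
    (h : StrongDual ℝ Y) : ∃ y ∈ T, h x ≤ h y := by
  by_contra hcon
  push Not at hcon
  have hc : Convex ℝ {y | h y < h x} := convex_halfSpace_lt h.toLinearMap.isLinear _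
  have h1 : h x < h x := convexHull_min hcon hc hx
  exact lt_irrefl _ h1

lemma exists_lt_of_mem_closure_convexHull {T : Set Y} {x : Y} (hx : x ∈ closure (convexHull ℝ T))
    (h : StrongDual ℝ Y) {c : ℝ} (hc : c < h x) : ∃ y ∈ T, c < h y := by
  have ho : IsOpen {y | c < h y} := isOpen_lt continuous_const h.continuous
  obtain ⟨z, hz, hzT⟩ := mem_closure_iff.1 hx _ ho hc
  obtain ⟨y, hy, hle⟩ := exists_le_of_mem_convexHull hzT h
  exact ⟨y, hy, lt_of_lt_of_le hz hle⟩

/-- The unit ball of a finite-dimensional subspace is approximated, uniformly in all functionals,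
by finitely many points that are almost `ℓ₁`-orthogonal to a finite-dimensional subspace. -/
lemma RelDaugavet.exists_finite_approx {K : Submodule ℝ Y}
    (hK : RelDaugavet (⊤ : Submodule ℝ (StrongDual ℝ Y)) K) {H E : Submodule ℝ Y} (hHK : H ≤ K)
    [FiniteDimensional ℝ H] [FiniteDimensional ℝ E] {ε : ℝ} (hε : 0 < ε) :
    ∃ F : Set Y, F.Finite ∧ (∀ y ∈ F, y ∈ K ∧ ‖y‖ ≤ 1 ∧ AlmostL1Orth E ε y) ∧
      ∀ x ∈ H, ‖x‖ ≤ 1 → ∀ h : StrongDual ℝ Y, ∃ y ∈ F, h x - ε * ‖h‖ ≤ h y := by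
  set T : Set Y := {y | y ∈ K ∧ ‖y‖ ≤ 1 ∧ AlmostL1Orth E ε y} with hT
  -- A functional separating `x` from the hull of `T` would give a slice of the ball of `K` without
  -- points of `T`.
  have hcl : ∀ x ∈ H, ‖x‖ ≤ 1 → x ∈ closure (convexHull ℝ T) := by
    intro x hx hx1
    by_contra hcon
    obtain ⟨h, u, hu1, hu2⟩ := geometric_hahn_banach_closed_point
      (convex_convexHull ℝ T).closure isClosed_closure hcon
    obtain ⟨y, hyK, hy1, hy, hyO⟩ := hK h trivial u ⟨x, hHK hx, hx1, hu2⟩ E inferInstance ε hε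
    exact lt_asymm hy (hu1 y (subset_closure (subset_convexHull ℝ T ⟨hyK, hy1, hyO⟩)))
  have hcomp : IsCompact ((H : Set Y) ∩ Metric.closedBall 0 1) := by
    have : IsCompact ((fun x : H => (x : Y)) '' Metric.closedBall (0 : H) 1) :=
      (isCompact_closedBall (0 : H) 1).image continuous_subtype_val
    convert this using 1
    ext x
    simp
    tauto
  have hp : ∀ x ∈ (H : Set Y) ∩ Metric.closedBall 0 1, ∃ s : Finset Y, ↑s ⊆ T ∧
      ∃ p ∈ convexHull ℝ (s : Set Y), dist x p < ε := by
    intro x hx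
    obtain ⟨p, hp, hd⟩ := Metric.mem_closure_iff.1 (hcl x hx.1 (by simpa using hx.2)) ε hε
    rw [convexHull_eq_union_convexHull_finite_subsets] at hp
    simp only [Set.mem_iUnion] at hp
    obtain ⟨s, hs, hp⟩ := hp
    exact ⟨s, hs, p, hp, hd⟩
  choose! s hsT p hps hpd using hp
  obtain ⟨t, htH, hcov⟩ := hcomp.elim_nhds_subcover (fun x => Metric.ball (p x) ε)
    fun x hx => Metric.isOpen_ball.mem_nhds (hpd x hx)
  refine ⟨⋃ x ∈ t, (s x : Set Y), t.finite_toSet.biUnion fun x _ => (s x).finite_toSet, ?_, ?_⟩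
  · intro y hy
    simp only [Set.mem_iUnion, exists_prop] at hy
    obtain ⟨x, hx, hy⟩ := hy
    exact hsT x (htH x hx) hy
  · intro x hx hx1 h
    have hxc := hcov ⟨hx, by simpa using hx1⟩
    simp only [Set.mem_iUnion, exists_prop, Metric.mem_ball] at hxc
    obtain ⟨z, hz, hd⟩ := hxc
    obtain ⟨y, hy, hle⟩ := exists_le_of_mem_convexHull (hps z (htH z hz)) h
    refine ⟨y, by simpa using ⟨z, hz, hy⟩, ?_⟩
    have h1 : h (x - p z) ≤ ‖h‖ * ε :=
      (le_abs_self _).trans (h.le_opNorm_of_le (by rw [← dist_eq_norm]; exact hd.le))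
    rw [map_sub] at h1
    linarith

/-- **Helly's theorem** on the solution of finitely many linear equations with a norm bound. -/
lemma exists_apply_eq_of_lower_bound {n : ℕ} (f : ℕ → StrongDual ℝ Y) {δ a R : ℝ} (hδ : 0 < δ)
    (hf : ∀ c : ℕ → ℝ, δ * ∑ j ∈ Finset.range n, |c j| ≤ ‖∑ j ∈ Finset.range n, c j • f j‖)
    (α : ℕ → ℝ) (hα : ∀ j, |α j| ≤ a) (hR : a < δ * R) :
    ∃ v : Y, ‖v‖ ≤ R ∧ ∀ j < n, f j v = α j := by
  classical
  have ha : 0 ≤ a := (abs_nonneg _).trans (hα 0)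
  have hR0 : 0 < R := by
    by_contra hcon
    push Not at hcon
    nlinarith
  set Φ : Y →L[ℝ] (Fin n → ℝ) := ContinuousLinearMap.pi fun j => f j with hΦ
  have hdual : ∀ l : (Fin n → ℝ) →ₗ[ℝ] ℝ, ∃ c : ℕ → ℝ,
      (∀ y : Fin n → ℝ, l y = ∑ j : Fin n, c j * y j) ∧
      ∀ y : Y, l (Φ y) = (∑ j ∈ Finset.range n, c j • f j) y := by
    intro l
    refine ⟨fun j => if hj : j < n then l (Pi.single ⟨j, hj⟩ 1) else 0, ?_, ?_⟩
    · intro y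
      rw [LinearMap.pi_apply_eq_sum_univ l y]
      refine Finset.sum_congr rfl fun j _ => ?_
      simp only [Fin.is_lt, dite_true, Fin.eta, smul_eq_mul]
      rw [mul_comm]
      congr 2
      ext i
      simp [Pi.single_apply, eq_comm]
    · intro y
      rw [LinearMap.pi_apply_eq_sum_univ l, Finset.sum_range, sum_apply]
      refine Finset.sum_congr rfl fun j _ => ?_
      simp only [Fin.is_lt, dite_true, Fin.eta, smul_eq_mul, smul_apply]
      rw [mul_comm]
      congr 2
      ext i
      simp [Pi.single_apply, eq_comm]
  -- A non-zero functional vanishing on the range would be a vanishing combination of the `f j`,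
  -- against the lower bound.
  have hsurj : Function.Surjective (Φ : Y →ₗ[ℝ] (Fin n → ℝ)) := by
    rw [← LinearMap.range_eq_top]
    by_contra hcon
    obtain ⟨l, hl0, hl⟩ := Submodule.exists_le_ker_of_lt_top _ (lt_top_iff_ne_top.2 hcon)
    obtain ⟨c, hc1, hc2⟩ := hdual l
    have h0 : (∑ j ∈ Finset.range n, c j • f j) = 0 := by
      ext y
      rw [← hc2]
      exact hl ⟨y, rfl⟩
    have h1 := hf c
    rw [h0, norm_zero] at h1
    have h2 : ∑ j ∈ Finset.range n, |c j| = 0 :=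
      le_antisymm (by nlinarith) (Finset.sum_nonneg fun _ _ => abs_nonneg _)
    rw [Finset.sum_eq_zero_iff_of_nonneg fun _ _ => abs_nonneg _] at h2
    apply hl0
    refine LinearMap.ext fun y => ?_
    rw [hc1]
    simp only [LinearMap.zero_apply]
    refine Finset.sum_eq_zero fun j _ => ?_
    rw [abs_eq_zero.1 (h2 j (Finset.mem_range.2 j.2)), zero_mul]
  have hopen : IsOpen (Φ '' Metric.ball 0 R) :=
    LinearMap.isOpenMap_of_finiteDimensional (Φ : Y →ₗ[ℝ] (Fin n → ℝ)) hsurj _ Metric.isOpen_ball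
  have hconv : Convex ℝ (Φ '' Metric.ball 0 R) :=
    (convex_ball (0 : Y) R).linear_image (Φ : Y →ₗ[ℝ] (Fin n → ℝ))
  by_cases hmem : (fun j : Fin n => α j) ∈ Φ '' Metric.ball 0 R
  · obtain ⟨v, hv, hve⟩ := hmem
    refine ⟨v, by simpa using (Metric.mem_ball.1 hv).le, fun j hj => ?_⟩
    exact congr_fun hve ⟨j, hj⟩
  -- Separating `α` from the open convex image of the ball gives a combination `g` with `R * ‖g‖ ≤ a
  -- * ∑ |c j|`, contradicting `a < δ * R`.
  · exfalso
    obtain ⟨l, hl⟩ := geometric_hahn_banach_open_point hconv hopen hmem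
    obtain ⟨c, hc1, hc2⟩ := hdual l.toLinearMap
    set g := ∑ j ∈ Finset.range n, c j • f j with hg
    set S := ∑ j ∈ Finset.range n, |c j| with hS
    have hS0 : 0 ≤ S := Finset.sum_nonneg fun _ _ => abs_nonneg _
    have h1 : l (fun j : Fin n => α j) ≤ S * a := by
      have := hc1 fun j : Fin n => α j
      rw [show l (fun j : Fin n => α j) = ∑ j : Fin n, c j * α j from this, hS, Finset.sum_range,
        Finset.sum_mul]
      refine Finset.sum_le_sum fun j _ => (le_abs_self _).trans ?_
      rw [abs_mul]
      exact mul_le_mul_of_nonneg_left (hα j) (abs_nonneg _)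
    have h2 : ∀ y : Y, ‖y‖ < R → g y < S * a := fun y hy =>
      ((hc2 y).symm.le.trans_lt (hl _ ⟨y, by simpa using hy, rfl⟩)).trans_le h1
    have h3 : 0 < S * a := by simpa using h2 0 (by simpa using hR0)
    have h4 : R * ‖g‖ ≤ S * a := by
      by_contra hcon
      push Not at hcon
      have h5 : S * a / R < ‖g‖ := by
        rw [div_lt_iff₀ hR0]
        linarith
      obtain ⟨x, hx1, hx⟩ := ContinuousLinearMap.exists_lt_apply_of_lt_opNorm g h5
      rw [div_lt_iff₀ hR0, Real.norm_eq_abs] at hx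
      have hn : ‖R • x‖ < R := by
        rw [norm_smul, Real.norm_of_nonneg hR0.le]
        nlinarith
      have a1 := h2 _ hn
      have a2 := h2 (-(R • x)) (by rwa [norm_neg])
      rw [map_smul, smul_eq_mul] at a1
      rw [map_neg, map_smul, smul_eq_mul] at a2
      rcases abs_cases (g x) with ⟨h6, _⟩ | ⟨h6, _⟩ <;> rw [h6] at hx <;> linarith
    have h6 := hf c
    have hS1 : 0 < S := by
      rcases hS0.eq_or_lt with h7 | h7
      · rw [← h7] at h3
        simp at h3
      · exact h7
    nlinarith [mul_le_mul_of_nonneg_left h6 hR0.le, mul_lt_mul_of_pos_left hR hS1]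

end Finite

end BanachSCD
namespace BanachSCD

/-! ### Construction of the adapted system. -/

section System

variable {Y : Type*} [NormedAddCommGroup Y] [NormedSpace ℝ Y]

/-- A sequence `f` of functionals with a bounded biorthogonal sequence `e`, adapted to an increasing
sequence `G` of finite-dimensional subspaces. The vectors `v n` split `x n` along the parity of the
indices, and the annihilators in `⋃ G n` of the functionals of a given parity are rich in vectors
that are almost `ℓ₁`-orthogonal to a given `G k`. -/
structure AdaptedSystem (x : ℕ → Y) where
  f : ℕ → StrongDual ℝ Y
  e : ℕ → Y
  v : ℕ → Y
  G : ℕ → Submodule ℝ Y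
  fin : ∀ n, FiniteDimensional ℝ (G n)
  mono : Monotone G
  norm_f : ∀ n, ‖f n‖ ≤ 1
  f_zero : ∀ n, ∀ g ∈ G n, f n g = 0
  x_mem : ∀ n, x n ∈ G (n + 1)
  e_mem : ∀ n, e n ∈ G (n + 1)
  v_mem : ∀ n, v n ∈ G (n + 1)
  norm_e : ∀ n, ‖e n‖ ≤ 4
  norm_v : ∀ n, ‖v n‖ ≤ 4
  f_e : ∀ j n, f j (e n) = if j = n then 1 else 0
  f_v : ∀ j n, f j (v n) = if j % 2 = 0 then f j (x n) else 0
  approx : ∀ i < 2, ∀ k, ∀ z ∈ G k, ‖z‖ ≤ 1 → (∀ j, j % 2 = i → f j z = 0) →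
    ∀ h : StrongDual ℝ Y, ∀ ε : ℝ, 0 < ε → ∃ m, ∃ y ∈ G m, ‖y‖ ≤ 1 ∧
      (∀ j, j % 2 = i → f j y = 0) ∧ AlmostL1Orth (G k) ε y ∧ h z - ε < h y

/-- The data of the first `n` stages of the construction of an adapted system. -/
def StageInv (n : ℕ) (p : Submodule ℝ Y × (ℕ → StrongDual ℝ Y)) : Prop :=
  FiniteDimensional ℝ p.1 ∧ (∀ j < n, ‖p.2 j‖ ≤ 1) ∧
    ∀ c : ℕ → ℝ, (1 / 2 + (1 / 2) ^ (n + 1)) * ∑ j ∈ Finset.range n, |c j| ≤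
      ‖∑ j ∈ Finset.range n, c j • p.2 j‖

/-- What one stage of the construction of an adapted system adds. -/
structure StageStep (x : Y) (n : ℕ) (p q : Submodule ℝ Y × (ℕ → StrongDual ℝ Y)) : Prop where
  le : p.1 ≤ q.1
  agree : ∀ j < n, q.2 j = p.2 j
  zero : ∀ g ∈ p.1, q.2 n g = 0
  x_mem : x ∈ q.1
  exists_e : ∃ e ∈ q.1, ‖e‖ ≤ 4 ∧ ∀ j ≤ n, q.2 j e = if j = n then 1 else 0
  exists_v : ∃ v ∈ q.1, ‖v‖ ≤ 4 ∧ ∀ j ≤ n, q.2 j v = if j % 2 = 0 then q.2 j x else 0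
  approx : ∀ i < 2, ∀ z ∈ p.1, ‖z‖ ≤ 1 → (∀ j ≤ n, j % 2 = i → q.2 j z = 0) →
    ∀ h : StrongDual ℝ Y, ∃ y ∈ q.1, ‖y‖ ≤ 1 ∧ (∀ j ≤ n, j % 2 = i → q.2 j y = 0) ∧
      AlmostL1Orth p.1 ((1 / 2) ^ n) y ∧ h z - (1 / 2) ^ n * ‖h‖ ≤ h y

lemma exists_almostL1Orth_annihilator [Nontrivial Y] (hY : DaugavetProperty Y)
    (G : Submodule ℝ Y) [FiniteDimensional ℝ G] (E : Submodule ℝ (StrongDual ℝ Y))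
    [FiniteDimensional ℝ E] {ε : ℝ} (hε : 0 < ε) :
    ∃ g : StrongDual ℝ Y, ‖g‖ ≤ 1 ∧ (∀ y ∈ G, g y = 0) ∧ AlmostL1Orth E ε g := by
  obtain ⟨s, hs⟩ := (Submodule.fg_iff_finiteDimensional G).2 inferInstance
  obtain ⟨K, hK, hKD⟩ := hY.relDaugavet_dual.iInf_ker s
    (fun y => NormedSpace.inclusionInDoubleDual ℝ Y y) fun y _ => ⟨y, rfl⟩
  -- The zero functional at level `-1` imposes no slice condition: only orthogonality and
  -- annihilation matter.
  obtain ⟨g, hgK, hg1, -, hgO⟩ := hKD 0 (Submodule.zero_mem _) (-1)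
    ⟨0, K.zero_mem, by simp, by simp⟩ E inferInstance ε hε
  refine ⟨g, hg1, fun y hy => ?_, hgO⟩
  have hle : G ≤ (g : Y →ₗ[ℝ] ℝ).ker := by
    rw [← hs, Submodule.span_le]
    intro z hz
    have := (hK g).1 hgK z hz
    rwa [NormedSpace.dual_def] at this
  exact hle hy

/-- With `r = (1/2)^(n+2)`, the loss factor `1 - r` lowers the `ℓ₁`-constant from `1/2 + 2r` to no
less than `1/2 + r`, because `r ≤ 1/4`. The constants thus stay above `1/2` for ever. -/
lemma StageInv.extend {n : ℕ} {p : Submodule ℝ Y × (ℕ → StrongDual ℝ Y)} (hp : StageInv n p)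
    {g : StrongDual ℝ Y} (hg1 : ‖g‖ ≤ 1)
    (hg : AlmostL1Orth (Submodule.span ℝ (p.2 '' Set.Iio n)) ((1 / 2) ^ (n + 2)) g)
    {G : Submodule ℝ Y} (hG : FiniteDimensional ℝ G) :
    StageInv (n + 1) (G, Function.update p.2 n g) := by
  refine ⟨hG, fun j hj => ?_, fun c => ?_⟩
  · rcases Nat.lt_succ_iff_lt_or_eq.1 hj with hj | rfl
    · simpa [Function.update_of_ne hj.ne] using hp.2.1 j hj
    · simpa using hg1
  · have hsum : ∑ j ∈ Finset.range n, c j • Function.update p.2 n g j =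
        ∑ j ∈ Finset.range n, c j • p.2 j := by
      refine Finset.sum_congr rfl fun j hj => ?_
      rw [Function.update_of_ne (Finset.mem_range.1 hj).ne]
    have hm : ∑ j ∈ Finset.range n, c j • p.2 j ∈ Submodule.span ℝ (p.2 '' Set.Iio n) :=
      Submodule.sum_mem _ fun j hj => Submodule.smul_mem _ _
        (Submodule.subset_span ⟨j, Finset.mem_range.1 hj, rfl⟩)
    have h1 := hg _ hm (c n)
    have h2 := hp.2.2 c
    simp only [Finset.sum_range_succ, hsum, Function.update_self]
    refine le_trans ?_ h1
    set S := ∑ j ∈ Finset.range n, |c j| with hS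
    have hS0 : 0 ≤ S := Finset.sum_nonneg fun _ _ => abs_nonneg _
    set r : ℝ := (1 / 2) ^ (n + 2) with hr
    have hr0 : 0 < r := by positivity
    have hr1 : r ≤ 1 / 4 := by
      have : r ≤ (1 / 2 : ℝ) ^ 2 :=
        pow_le_pow_of_le_one (by norm_num) (by norm_num) (by omega)
      norm_num at this ⊢
      linarith
    have hr2 : (1 / 2 : ℝ) ^ (n + 1) = 2 * r := by rw [hr, pow_succ (1 / 2 : ℝ) (n + 1)]; ring
    rw [hr2] at h2
    have h3 : (1 - r) * ((1 / 2 + 2 * r) * S + |c n|) ≤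
        (1 - r) * (‖∑ j ∈ Finset.range n, c j • p.2 j‖ + |c n|) :=
      mul_le_mul_of_nonneg_left (by linarith) (by linarith)
    refine le_trans ?_ h3
    have h4 : 0 ≤ |c n| * (1 / 2 - 2 * r) := mul_nonneg (abs_nonneg _) (by linarith)
    have h5 : 0 ≤ S * (r * (1 / 2 - 2 * r)) :=
      mul_nonneg hS0 (mul_nonneg hr0.le (by linarith))
    nlinarith

lemma exists_stageStep [Nontrivial Y] (hY : DaugavetProperty Y) {x : Y} (hx : ‖x‖ ≤ 1) (n : ℕ)
    (p : Submodule ℝ Y × (ℕ → StrongDual ℝ Y)) (hp : StageInv n p) :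
    ∃ q, StageInv (n + 1) q ∧ StageStep x n p q := by
  have hfin := hp.1
  have : FiniteDimensional ℝ (Submodule.span ℝ (p.2 '' Set.Iio n)) :=
    FiniteDimensional.span_of_finite ℝ ((Set.finite_Iio n).image _)
  obtain ⟨g, hg1, hgG, hgO⟩ := exists_almostL1Orth_annihilator hY p.1
    (Submodule.span ℝ (p.2 '' Set.Iio n)) (ε := (1 / 2) ^ (n + 2)) (by positivity)
  set f' := Function.update p.2 n g with hf'
  have hext := fun G hG => hp.extend (G := G) hg1 hgO hG
  have hlow : ∀ c : ℕ → ℝ, (1 / 2) * ∑ j ∈ Finset.range (n + 1), |c j| ≤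
      ‖∑ j ∈ Finset.range (n + 1), c j • f' j‖ := by
    intro c
    refine le_trans ?_ ((hext p.1 hfin).2.2 c)
    refine mul_le_mul_of_nonneg_right ?_ (Finset.sum_nonneg fun _ _ => abs_nonneg _)
    have : (0 : ℝ) < (1 / 2) ^ (n + 1 + 1) := by positivity
    linarith
  have hf'1 : ∀ j < n + 1, ‖f' j‖ ≤ 1 := (hext p.1 hfin).2.1
  -- With lower constant `1/2` and data bounded by one, Helly's theorem allows any radius above `2`.
  obtain ⟨e, he4, he⟩ := exists_apply_eq_of_lower_bound f' (by norm_num) hlow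
    (fun j => if j = n then 1 else 0) (a := 1) (R := 4)
    (fun j => by split_ifs <;> simp) (by norm_num)
  -- `v` copies `x` on the even functionals and is killed by the odd ones. The cut-off `j < n + 1`
  -- is there because the bound on the data is asked for every `j`.
  obtain ⟨v, hv4, hv⟩ := exists_apply_eq_of_lower_bound f' (by norm_num) hlow
    (fun j => if j < n + 1 ∧ j % 2 = 0 then f' j x else 0) (a := 1) (R := 4)
    (fun j => by
      split_ifs with hj
      · exact abs_apply_le_one (hf'1 j hj.1) hx
      · simp) (by norm_num)
  have hA : ∀ i : ℕ, ∃ F : Set Y, F.Finite ∧ (∀ y ∈ F, (∀ j ≤ n, j % 2 = i → f' j y = 0) ∧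
      ‖y‖ ≤ 1 ∧ AlmostL1Orth p.1 ((1 / 2) ^ n) y) ∧
      ∀ z ∈ p.1, ‖z‖ ≤ 1 → (∀ j ≤ n, j % 2 = i → f' j z = 0) →
        ∀ h : StrongDual ℝ Y, ∃ y ∈ F, h z - (1 / 2) ^ n * ‖h‖ ≤ h y := by
    intro i
    obtain ⟨K, hK, hKD⟩ := hY.relDaugavet.iInf_ker
      ((Finset.range (n + 1)).filter fun j => j % 2 = i) f' fun _ _ => trivial
    have hK' : ∀ y, y ∈ K ↔ ∀ j ≤ n, j % 2 = i → f' j y = 0 := by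
      intro y
      rw [hK]
      simp
    obtain ⟨F, hF, hF1, hF2⟩ := hKD.exists_finite_approx (H := p.1 ⊓ K) (E := p.1) inf_le_right
      (ε := (1 / 2) ^ n) (by positivity)
    refine ⟨F, hF, fun y hy => ?_, fun z hz hz1 hzK h => hF2 z ⟨hz, (hK' z).2 hzK⟩ hz1 h⟩
    obtain ⟨h1, h2, h3⟩ := hF1 y hy
    exact ⟨(hK' y).1 h1, h2, h3⟩
  choose F hF hF1 hF2 using hA
  set S : Set Y := {x, e, v} ∪ (F 0 ∪ F 1) with hS
  have hSf : S.Finite := (Set.toFinite _).union ((hF 0).union (hF 1))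
  have : FiniteDimensional ℝ (Submodule.span ℝ S) := FiniteDimensional.span_of_finite ℝ hSf
  have hmem : ∀ y ∈ S, y ∈ p.1 ⊔ Submodule.span ℝ S := fun y hy =>
    Submodule.mem_sup_right (Submodule.subset_span hy)
  refine ⟨(p.1 ⊔ Submodule.span ℝ S, f'), hext _ inferInstance, le_sup_left, fun j hj => ?_,
    fun y hy => ?_, hmem _ (by simp [hS]), ⟨e, hmem _ (by simp [hS]), he4, fun j hj => ?_⟩,
    ⟨v, hmem _ (by simp [hS]), hv4, fun j hj => ?_⟩, fun i hi z hz hz1 hzi h => ?_⟩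
  · simp [hf', Function.update_of_ne hj.ne]
  · simpa [hf'] using hgG y hy
  · exact he j (Nat.lt_succ_of_le hj)
  · have := hv j (Nat.lt_succ_of_le hj)
    simpa [Nat.lt_succ_of_le hj] using this
  · obtain ⟨y, hy, hle⟩ := hF2 i z hz hz1 hzi h
    obtain ⟨h1, h2, h3⟩ := hF1 i y hy
    refine ⟨y, hmem y ?_, h2, h1, h3, hle⟩
    interval_cases i <;> simp [hS, hy]

theorem exists_adaptedSystem [Nontrivial Y] (hY : DaugavetProperty Y) (x : ℕ → Y)
    (hx : ∀ n, ‖x n‖ ≤ 1) : Nonempty (AdaptedSystem x) := by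
  have hstep : ∀ n p, StageInv n p → ∃ q, StageInv (n + 1) q ∧ StageStep (x n) n p q :=
    fun n p hp => exists_stageStep hY (hx n) n p hp
  choose! next hnext1 hnext2 using hstep
  let s : ℕ → Submodule ℝ Y × (ℕ → StrongDual ℝ Y) := fun n => Nat.rec (⊥, 0) next n
  have hinv : ∀ n, StageInv n (s n) := by
    intro n
    induction n with
    | zero => exact ⟨inferInstanceAs (FiniteDimensional ℝ (⊥ : Submodule ℝ Y)), by simp, by simp⟩
    | succ n ih => exact hnext1 n (s n) ih
  have hst : ∀ n, StageStep (x n) n (s n) (s (n + 1)) := fun n => hnext2 n (s n) (hinv n)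
  set f : ℕ → StrongDual ℝ Y := fun j => (s (j + 1)).2 j with hf
  have hagree : ∀ m j, j < m → (s m).2 j = f j := by
    intro m j hj
    induction m, hj using Nat.le_induction with
    | base => rfl
    | succ m hm ih => rw [(hst m).agree j hm, ih]
  have hmono : Monotone fun n => (s n).1 := monotone_nat_of_le_succ fun n => (hst n).le
  have hzero : ∀ n, ∀ g ∈ (s n).1, f n g = 0 := fun n g hg => (hst n).zero g hg
  have hzero' : ∀ j n, n < j → ∀ g ∈ (s (n + 1)).1, f j g = 0 := fun j n hj g hg =>
    hzero j g (hmono (Nat.succ_le_of_lt hj) hg)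
  choose e he he4 hfe using fun n => (hst n).exists_e
  choose v hv hv4 hfv using fun n => (hst n).exists_v
  refine ⟨{ f := f, e := e, v := v, G := fun n => (s n).1, fin := fun n => (hinv n).1,
            mono := hmono, norm_f := fun n => (hinv (n + 1)).2.1 n n.lt_succ_self,
            f_zero := hzero, x_mem := fun n => (hst n).x_mem, e_mem := he, v_mem := hv,
            norm_e := he4, norm_v := hv4, f_e := ?_, f_v := ?_, approx := ?_ }⟩
  · intro j n
    rcases le_or_gt j n with hj | hj
    · rw [← hfe n j hj, hagree (n + 1) j (Nat.lt_succ_of_le hj)]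
    · rw [hzero' j n hj _ (he n), if_neg hj.ne']
  · intro j n
    rcases le_or_gt j n with hj | hj
    · have := hfv n j hj
      rwa [hagree (n + 1) j (Nat.lt_succ_of_le hj)] at this
    · rw [hzero' j n hj _ (hv n), hzero' j n hj _ (hst n).x_mem, ite_self]
  · intro i hi k z hz hz1 hzi h ε hε
    have hC : 0 < ‖h‖ + 1 := by positivity
    obtain ⟨N, hN⟩ := exists_pow_lt_of_lt_one (div_pos hε hC) (by norm_num : (1 / 2 : ℝ) < 1)
    -- Stage `m` is late enough for tolerance `ε` and for `G m` to contain `z`. Its points satisfy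
    -- the parity conditions up to `m`; later functionals vanish on `G (m + 1)`.
    set m := max N k with hm
    have hpm : (1 / 2 : ℝ) ^ m * (‖h‖ + 1) < ε := by
      rw [← lt_div_iff₀ hC]
      exact (pow_le_pow_of_le_one (by norm_num) (by norm_num) (le_max_left _ _)).trans_lt hN
    have hp0 : (0 : ℝ) < (1 / 2) ^ m := by positivity
    obtain ⟨y, hy, hy1, hyi, hyO, hyh⟩ := (hst m).approx i hi z (hmono (le_max_right N k) hz) hz1
      (fun j hj hji => by rw [hagree (m + 1) j (Nat.lt_succ_of_le hj)]; exact hzi j hji) h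
    refine ⟨m + 1, y, hy, hy1, fun j hji => ?_, hyO.mono (hmono (le_max_right N k)) ?_, ?_⟩
    · rcases le_or_gt j m with hj | hj
      · rw [← hagree (m + 1) j (Nat.lt_succ_of_le hj)]
        exact hyi j hj hji
      · exact hzero' j m hj _ hy
    · nlinarith [norm_nonneg h]
    · nlinarith [norm_nonneg h]

end System

end BanachSCD
namespace BanachSCD

/-! ### Criteria for being, and for not being, slicely countably determined. -/

section SCD

variable {Y : Type*} [NormedAddCommGroup Y] [NormedSpace ℝ Y]

/-- If `F` exposes `w` among the points of `V`, then the slices of the closed convex hull of `V`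
given by `F` shrink to `w`. -/
lemma norm_sub_le_of_exposed {V : Set Y} {R : ℝ} (hR : ∀ v ∈ V, ‖v‖ ≤ R) {w : Y} (hw : w ∈ V)
    {F : StrongDual ℝ Y} {c s : ℝ} (hcs : c ≤ s) (hs : ∀ v ∈ V, F v ≤ s)
    (hF : ∀ v ∈ V, c < F v → v = w) :
    ∀ x ∈ closure (convexHull ℝ V), (s - c) * ‖x - w‖ ≤ 2 * R * (s - F x) := by
  have hR0 : 0 ≤ R := (norm_nonneg w).trans (hR w hw)
  -- The desired inequality is convex and closed in `x`, so checking it on `V` suffices.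
  have hcl : IsClosed {x : Y | (s - c) * ‖x - w‖ + 2 * R * F x ≤ 2 * R * s} :=
    isClosed_le (by fun_prop) continuous_const
  have hcv : Convex ℝ {x : Y | (s - c) * ‖x - w‖ + 2 * R * F x ≤ 2 * R * s} := by
    intro a ha b hb p q hp hq hpq
    simp only [Set.mem_ofPred_eq] at ha hb ⊢
    have h1 : ‖p • a + q • b - w‖ ≤ p * ‖a - w‖ + q * ‖b - w‖ := by
      have h2 : p • a + q • b - w = p • (a - w) + q • (b - w) := by
        have : w = (p + q) • w := by rw [hpq, one_smul]
        conv_lhs => rw [this]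
        module
      rw [h2]
      refine (norm_add_le _ _).trans ?_
      rw [norm_smul, norm_smul, Real.norm_of_nonneg hp, Real.norm_of_nonneg hq]
    have h3 := mul_le_mul_of_nonneg_left h1 (sub_nonneg.2 hcs)
    have h4 := mul_le_mul_of_nonneg_left ha hp
    have h5 := mul_le_mul_of_nonneg_left hb hq
    have h6 : F (p • a + q • b) = p * F a + q * F b := by simp
    have h7 : 2 * R * s = p * (2 * R * s) + q * (2 * R * s) := by rw [← add_mul, hpq, one_mul]
    rw [h6, h7]
    linarith
  intro x hx
  have hsub : V ⊆ {x : Y | (s - c) * ‖x - w‖ + 2 * R * F x ≤ 2 * R * s} := by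
    intro v hv
    simp only [Set.mem_ofPred_eq]
    by_cases hcv : c < F v
    · rw [hF v hv hcv, sub_self, norm_zero, mul_zero, zero_add]
      exact mul_le_mul_of_nonneg_left (hs w hw) (by positivity)
    · push Not at hcv
      have h1 : ‖v - w‖ ≤ 2 * R := by
        have := norm_sub_le v w
        linarith [hR v hv, hR w hw]
      have h2 := mul_le_mul_of_nonneg_left h1 (sub_nonneg.2 hcs)
      have h3 := mul_le_mul_of_nonneg_left hcv (by positivity : 0 ≤ 2 * R)
      linarith
  have := closure_minimal (convexHull_min hsub hcv) hcl hx
  simp only [Set.mem_ofPred_eq] at this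
  linarith

/-- The closed convex hull of a countable bounded set of exposed points is slicely countably
determined. -/
theorem isSCD_closure_convexHull {ι : Type*} [Countable ι] [Nonempty ι] {v : ι → Y} {R : ℝ}
    (hR : ∀ i, ‖v i‖ ≤ R)
    (hF : ∀ i, ∃ F : StrongDual ℝ Y, ∃ c : ℝ, F ≠ 0 ∧ c < F (v i) ∧ ∀ j, c < F (v j) → v j = v i) :
    IsSCD (closure (convexHull ℝ (Set.range v))) := by
  set A := closure (convexHull ℝ (Set.range v)) with hA
  have hbd : Bornology.IsBounded A := by
    refine Bornology.IsBounded.closure (isBounded_convexHull.2 ?_)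
    refine isBounded_iff_forall_norm_le.2 ⟨R, ?_⟩
    rintro _ ⟨i, rfl⟩
    exact hR i
  have hvA : ∀ i, v i ∈ A := fun i => subset_closure (subset_convexHull ℝ _ ⟨i, rfl⟩)
  refine ⟨hbd, ?_⟩
  choose F c hF0 hc hexp using hF
  have hbdd : ∀ i, BddAbove (F i '' A) := fun i =>
    ((F i).lipschitz.isBounded_image hbd).bddAbove
  set S : ι × ℕ → Set Y := fun q =>
    {x ∈ A | sSup (F q.1 '' A) - 1 / ((q.2 : ℝ) + 1) < F q.1 x} with hS
  have hSlice : ∀ q, IsSlice A (S q) := by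
    intro q
    have hpos : (0 : ℝ) < 1 / ((q.2 : ℝ) + 1) := by positivity
    refine ⟨?_, F q.1, hF0 _, _, hpos, rfl⟩
    obtain ⟨-, ⟨x, hx, rfl⟩, hlt⟩ := exists_lt_of_lt_csSup
      (Set.Nonempty.image (F q.1) (⟨v q.1, hvA _⟩ : A.Nonempty)) (sub_lt_self _ hpos)
    exact ⟨x, hx, hlt⟩
  obtain ⟨φ, hφ⟩ := exists_surjective_nat (ι × ℕ)
  refine ⟨S ∘ φ, fun n => hSlice _, fun n => ⟨(hSlice _).1, fun x hx => hx.1⟩, fun B hB => ?_⟩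
  have hB' : ∀ q, (B ∩ S q).Nonempty := fun q => by
    obtain ⟨n, rfl⟩ := hφ q
    exact hB n
  refine closure_minimal (convexHull_min ?_ (convex_convexHull ℝ B).closure) isClosed_closure
  rintro _ ⟨i, rfl⟩
  suffices v i ∈ closure B from closure_mono (subset_convexHull ℝ B) this
  rw [Metric.mem_closure_iff]
  intro ε hε
  set s := sSup (F i '' A) with hs
  have hsF : ∀ x ∈ A, F i x ≤ s := fun x hx => le_csSup (hbdd i) ⟨x, hx, rfl⟩
  have hcs : 0 < s - c i := by linarith [hc i, hsF _ (hvA i)]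
  have hR0 : 0 ≤ R := (norm_nonneg _).trans (hR i)
  obtain ⟨k, hk⟩ := exists_nat_one_div_lt
    (show 0 < ε * (s - c i) / (2 * R + 1) by positivity)
  rw [lt_div_iff₀ (by positivity)] at hk
  obtain ⟨x, hxB, hxA, hx⟩ := hB' (i, k)
  refine ⟨x, hxB, ?_⟩
  have h1 := norm_sub_le_of_exposed (V := Set.range v) (R := R) (by rintro _ ⟨j, rfl⟩; exact hR j)
    (w := v i) ⟨i, rfl⟩ (F := F i) (c := c i) (s := s) (by linarith)
    (by rintro _ ⟨j, rfl⟩; exact hsF _ (hvA j))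
    (by rintro _ ⟨j, rfl⟩ hj; exact hexp i j hj) x hxA
  simp only at hx
  rw [dist_comm, dist_eq_norm]
  have hpos : (0 : ℝ) < 1 / ((k : ℝ) + 1) := by positivity
  have h2 : 2 * R * (s - F i x) ≤ 2 * R * (1 / ((k : ℝ) + 1)) :=
    mul_le_mul_of_nonneg_left (by linarith) (by positivity)
  have h3 : (s - c i) * ‖x - v i‖ < (s - c i) * ε := by linarith
  exact lt_of_mul_lt_mul_left h3 hcs.le

/-- A set is not slicely countably determined if there is an increasing sequence of subspaces such
that every slice contains points of their union almost `ℓ₁`-orthogonal to any of them. -/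
theorem not_isSCD_of_almostL1Orth {U : Set Y} {G : ℕ → Submodule ℝ Y} (hG : Monotone G)
    {x : Y} (hxU : x ∈ U) {k₀ : ℕ} (hxG : x ∈ G k₀) (hx0 : x ≠ 0)
    (hU : ∀ S, IsSlice U S → ∀ k, ∀ ε : ℝ, 0 < ε →
      ∃ m, ∃ y ∈ G m, y ∈ S ∧ AlmostL1Orth (G k) ε y) : ¬ IsSCD U := by
  rintro ⟨-, S, hS, -, hdet⟩
  -- Choose `p n` in the `n`-th slice, almost orthogonal to a `G` containing `x` and all earlier
  -- choices. Then `x` stays at distance at least `‖x‖ / 2` from the span of the `p n`, though they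
  -- meet every slice.
  have hstep : ∀ n k, ∃ q : ℕ × Y, k ≤ q.1 ∧ q.2 ∈ G q.1 ∧ q.2 ∈ S n ∧
      AlmostL1Orth (G k) ((1 / 2) ^ (n + 2)) q.2 := by
    intro n k
    obtain ⟨m, y, hy, hyS, hyO⟩ := hU (S n) (hS n) k ((1 / 2) ^ (n + 2)) (by positivity)
    exact ⟨(max m k, y), le_max_right _ _, hG (le_max_left _ _) hy, hyS, hyO⟩
  choose next h1 h2 h3 h4 using hstep
  let k : ℕ → ℕ := fun n => Nat.rec k₀ (fun n k => (next n k).1) n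
  set p : ℕ → Y := fun n => (next n (k n)).2 with hp
  have hpG : ∀ n, p n ∈ G (k (n + 1)) := fun n => h2 n (k n)
  have hkmono : Monotone k := monotone_nat_of_le_succ fun n => h1 n (k n)
  have hspan : ∀ n, Submodule.span ℝ (p '' Set.Iio n) ≤ G (k n) := by
    intro n
    rw [Submodule.span_le]
    rintro _ ⟨j, hj, rfl⟩
    exact hG (hkmono (Nat.succ_le_of_lt hj)) (hpG j)
  have hdist : ∀ n, ∀ z ∈ Submodule.span ℝ (p '' Set.Iio n),
      (1 / 2 + (1 / 2) ^ (n + 1)) * ‖x‖ ≤ ‖x - z‖ := by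
    intro n
    induction n with
    | zero =>
      intro z hz
      have : z = 0 := by simpa using hz
      subst this
      norm_num
    | succ n ih =>
      intro z hz
      rw [show Set.Iio (n + 1) = insert n (Set.Iio n) by ext; simp, Set.image_insert_eq,
        Submodule.mem_span_insert] at hz
      obtain ⟨a, z', hz', rfl⟩ := hz
      have h5 := ih z' hz'
      have hm : x - z' ∈ G (k n) :=
        (G (k n)).sub_mem (hG (hkmono n.zero_le) hxG) (hspan n hz')
      have h6 := h4 n (k n) _ hm (-a)
      have e1 : x - z' + (-a) • (next n (k n)).2 = x - (a • p n + z') := by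
        simp only [hp]
        module
      rw [e1] at h6
      refine le_trans ?_ h6
      set r : ℝ := (1 / 2) ^ (n + 2) with hr
      have hr0 : 0 < r := by positivity
      have hr1 : r ≤ 1 / 4 := by
        have : r ≤ (1 / 2 : ℝ) ^ 2 :=
          pow_le_pow_of_le_one (by norm_num) (by norm_num) (by omega)
        norm_num at this ⊢
        linarith
      have hr2 : (1 / 2 : ℝ) ^ (n + 1) = 2 * r := by rw [hr, pow_succ (1 / 2 : ℝ) (n + 1)]; ring
      rw [hr2] at h5
      have h7 : (1 - r) * ((1 / 2 + 2 * r) * ‖x‖) ≤ (1 - r) * (‖x - z'‖ + |(-a)|) :=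
        mul_le_mul_of_nonneg_left (by linarith [abs_nonneg (-a)]) (by linarith)
      refine le_trans ?_ h7
      have h8 : 0 ≤ ‖x‖ * (r * (1 / 2 - 2 * r)) :=
        mul_nonneg (norm_nonneg _) (mul_nonneg hr0.le (by linarith))
      linarith
  have hmem : x ∈ closure (convexHull ℝ (Set.range p)) :=
    hdet (Set.range p) (fun n => ⟨p n, ⟨n, rfl⟩, h3 n (k n)⟩) hxU
  have hn : 0 < ‖x‖ := norm_pos_iff.2 hx0
  obtain ⟨z, hz, hd⟩ := Metric.mem_closure_iff.1 hmem (‖x‖ / 2) (by positivity)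
  rw [convexHull_eq_union_convexHull_finite_subsets] at hz
  simp only [Set.mem_iUnion] at hz
  obtain ⟨t, ht, hz⟩ := hz
  obtain ⟨N, hN⟩ : ∃ N, (t : Set Y) ⊆ p '' Set.Iio N := by
    have hj : ∀ y ∈ t, ∃ j, p j = y := fun y hy => ht hy
    choose! j hj using hj
    exact ⟨t.sup j + 1, fun y hy => ⟨j y, Nat.lt_succ_of_le (Finset.le_sup hy), hj y hy⟩⟩
  have hzs : z ∈ Submodule.span ℝ (p '' Set.Iio N) :=
    convexHull_min (hN.trans Submodule.subset_span) (Submodule.convex _) hz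
  have h9 := hdist N z hzs
  rw [dist_eq_norm] at hd
  have h10 : (0 : ℝ) < (1 / 2) ^ (N + 1) := by positivity
  nlinarith

/-- A bounded closed convex symmetric set with a ball around `0` is the unit ball of an equivalent
norm. -/
lemma isEquivNormUnitBall_of_closedBall_subset {B : Set Y} (hconv : Convex ℝ B)
    (hclosed : IsClosed B) (hbd : Bornology.IsBounded B) (hsymm : -B = B) {r : ℝ} (hr : 0 < r)
    (hrB : Metric.closedBall 0 r ⊆ B) : IsEquivNormUnitBall B := by
  have hnhds : B ∈ nhds (0 : Y) := Filter.mem_of_superset (Metric.closedBall_mem_nhds 0 hr) hrB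
  have h0 : (0 : Y) ∈ B := mem_of_mem_nhds hnhds
  have hneg : ∀ x ∈ B, -x ∈ B := fun x hx => by
    rw [← hsymm]
    simpa using hx
  have hbal : Balanced ℝ B := by
    intro a ha
    rintro _ ⟨x, hx, rfl⟩
    rw [Real.norm_eq_abs] at ha
    rcases le_total 0 a with h | h
    · rw [abs_of_nonneg h] at ha
      exact (hconv.starConvex h0).smul_mem hx h ha
    · rw [abs_of_nonpos h] at ha
      have := (hconv.starConvex h0).smul_mem (hneg x hx) (neg_nonneg.2 h) ha
      simpa using this
  have habs : Absorbent ℝ B := absorbent_nhds_zero hnhds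
  obtain ⟨R, hR⟩ := hbd.subset_closedBall 0
  have hR' : B ⊆ Metric.closedBall 0 (max R 1) :=
    hR.trans (Metric.closedBall_subset_closedBall (le_max_left _ _))
  have hR0 : (0 : ℝ) < max R 1 := lt_max_of_lt_right one_pos
  refine ⟨gaugeSeminorm hbal hconv habs, ⟨(max R 1)⁻¹, r⁻¹, by positivity, by positivity,
    fun x => ⟨?_, ?_⟩⟩, ?_⟩
  · change (max R 1)⁻¹ * ‖x‖ ≤ gauge B x
    have := gauge_mono habs hR' x
    rw [gauge_closedBall hR0.le, div_eq_inv_mul] at this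
    exact this
  · change gauge B x ≤ r⁻¹ * ‖x‖
    have := gauge_mono (absorbent_nhds_zero (Metric.closedBall_mem_nhds (0 : Y) hr)) hrB x
    rw [gauge_closedBall hr.le, div_eq_inv_mul] at this
    exact this
  · ext x
    change x ∈ B ↔ gauge B x ≤ 1
    rw [gauge_le_one_iff_mem_closure hconv hnhds, hclosed.closure_eq]

end SCD

end BanachSCD
namespace BanachSCD

/-! ### The two bodies attached to an adapted system. -/

namespace AdaptedSystem

variable {Y : Type*} [NormedAddCommGroup Y] [NormedSpace ℝ Y] {x : ℕ → Y}

/-- The part of `⋃ G n` on which all functionals with index of parity `i` vanish. -/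
def rich (D : AdaptedSystem x) (i : ℕ) : Submodule ℝ Y :=
  (⨆ n, D.G n) ⊓ ⨅ j, ⨅ (_ : j % 2 = i), (D.f j : Y →ₗ[ℝ] ℝ).ker

lemma mem_rich (D : AdaptedSystem x) {i : ℕ} {z : Y} :
    z ∈ D.rich i ↔ (∃ k, z ∈ D.G k) ∧ ∀ j, j % 2 = i → D.f j z = 0 := by
  rw [rich, Submodule.mem_inf, Submodule.mem_iSup_of_directed _ D.mono.directed_le]
  simp [Submodule.mem_iInf]

/-- The crossing of parities behind the counterexample: the vectors tilting the vertices of one body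
lie in the rich subspace of the other. -/
lemma e_mem_rich (D : AdaptedSystem x) {i n : ℕ} (hn : n % 2 ≠ i) : D.e n ∈ D.rich i := by
  refine D.mem_rich.2 ⟨⟨_, D.e_mem n⟩, fun j hj => ?_⟩
  rw [D.f_e, if_neg]
  rintro rfl
  exact hn hj

lemma v_mem_rich (D : AdaptedSystem x) (n : ℕ) : D.v n ∈ D.rich 1 := by
  refine D.mem_rich.2 ⟨⟨_, D.v_mem n⟩, fun j hj => ?_⟩
  rw [D.f_v, if_neg (by omega)]

lemma sub_v_mem_rich (D : AdaptedSystem x) (n : ℕ) : x n - D.v n ∈ D.rich 0 := by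
  refine D.mem_rich.2 ⟨⟨_, (D.G (n + 1)).sub_mem (D.x_mem n) (D.v_mem n)⟩, fun j hj => ?_⟩
  rw [map_sub, D.f_v, if_pos hj, sub_self]

lemma exists_unit_mem_rich (D : AdaptedSystem x) {i : ℕ} (hi : i < 2) :
    ∃ z ∈ D.rich i, ‖z‖ = 1 := by
  have h1 : D.e (1 - i) ∈ D.rich i := D.e_mem_rich (by omega)
  have h0 : D.e (1 - i) ≠ 0 := by
    intro h0
    have := D.f_e (1 - i) (1 - i)
    rw [h0] at this
    simp at this
  exact ⟨‖D.e (1 - i)‖⁻¹ • D.e (1 - i), Submodule.smul_mem _ _ h1, norm_smul_inv_norm h0⟩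

/-- Every point recurs infinitely often, because the tilt in `uVec` disappears only for large `n`.
-/
lemma exists_dense_seq (D : AdaptedSystem x) {i : ℕ} (hi : i < 2) :
    ∃ y : ℕ → Y, (∀ n, y n ∈ D.rich i ∧ ‖y n‖ = 1) ∧
      ∀ z ∈ D.rich i, ‖z‖ = 1 → ∀ ε : ℝ, 0 < ε → ∀ N, ∃ n, N ≤ n ∧ ‖z - y n‖ < ε := by
  set S : Set Y := {z | z ∈ D.rich i ∧ ‖z‖ = 1} with hS
  have hsep : TopologicalSpace.IsSeparable S := by
    refine TopologicalSpace.IsSeparable.mono (s := ⋃ k, (D.G k : Set Y)) ?_ ?_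
    · refine TopologicalSpace.IsSeparable.iUnion fun k => ?_
      have := D.fin k
      obtain ⟨s, hs⟩ := (Submodule.fg_iff_finiteDimensional (D.G k)).2 inferInstance
      rw [← hs]
      exact s.countable_toSet.isSeparable.span
    · intro z hz
      simpa using (D.mem_rich.1 hz.1).1
  have := hsep.separableSpace
  obtain ⟨z₀, hz₀, hz₀1⟩ := D.exists_unit_mem_rich hi
  have : Nonempty S := ⟨⟨z₀, hz₀, hz₀1⟩⟩
  refine ⟨fun n => (TopologicalSpace.denseSeq S n.unpair.1 : Y),
    fun n => Subtype.coe_prop (TopologicalSpace.denseSeq S n.unpair.1),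
    fun z hz hz1 ε hε N => ?_⟩
  obtain ⟨m, hm⟩ := (TopologicalSpace.denseRange_denseSeq S).exists_dist_lt ⟨z, hz, hz1⟩ hε
  refine ⟨Nat.pair m N, Nat.right_le_pair m N, ?_⟩
  simp only [Nat.unpair_pair]
  rw [← dist_eq_norm]
  exact hm

/-- The number `1` or `-1` given by a sign. -/
noncomputable def sign (a : Bool) : ℝ := if a then 1 else -1

/-- A point of the unit ball of `D.rich i`, slightly moved in the direction of a vector `e`. -/
noncomputable def uVec (D : AdaptedSystem x) (i : ℕ) (y : ℕ → Y) (n : ℕ) : Y :=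
  (1 - 1 / ((n : ℝ) + 2)) • y n + (1 / ((n : ℝ) + 2) / 4) • D.e (4 * n + i)

/-- A point with a small component along `x n`, moved in the direction of a vector `e`. -/
noncomputable def wVec (D : AdaptedSystem x) (i : ℕ) (n : ℕ) (b : Bool) : Y :=
  (1 / 8 : ℝ) • D.e (4 * n + 2 + i) + (sign b / 100) • x n

/-- The points whose closed convex hull is the slicely countably determined set of parity `i`. -/
noncomputable def vertex (D : AdaptedSystem x) (i : ℕ) (y : ℕ → Y) : Bool × (ℕ ⊕ ℕ × Bool) → Y
  | (a, Sum.inl n) => sign a • D.uVec i y n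
  | (a, Sum.inr (n, b)) => sign a • D.wVec i n b

/-- The slicely countably determined set of parity `i`. -/
noncomputable def body (D : AdaptedSystem x) (i : ℕ) (y : ℕ → Y) : Set Y :=
  closure (convexHull ℝ (Set.range (D.vertex i y)))

lemma abs_sign (a : Bool) : |sign a| = 1 := by cases a <;> simp [sign]

lemma vertex_not (D : AdaptedSystem x) (i : ℕ) (y : ℕ → Y) (a : Bool) (q : ℕ ⊕ ℕ × Bool) :
    D.vertex i y (!a, q) = -D.vertex i y (a, q) := by
  rcases q with n | ⟨n, b⟩ <;> cases a <;> simp [vertex, sign]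

lemma body_symm (D : AdaptedSystem x) (i : ℕ) (y : ℕ → Y) : -D.body i y = D.body i y := by
  have h : -Set.range (D.vertex i y) = Set.range (D.vertex i y) := by
    ext z
    simp only [Set.mem_neg, Set.mem_range]
    constructor
    · rintro ⟨⟨a, q⟩, h⟩
      exact ⟨(!a, q), by rw [vertex_not, h, neg_neg]⟩
    · rintro ⟨⟨a, q⟩, rfl⟩
      exact ⟨(!a, q), by rw [vertex_not]⟩
  rw [body, neg_closure, ← convexHull_neg, h]

lemma abs_apply_e_le (D : AdaptedSystem x) {φ : StrongDual ℝ Y} (hφ : ‖φ‖ ≤ 1) (n : ℕ) :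
    |φ (D.e n)| ≤ 4 := by
  have := φ.le_opNorm (D.e n)
  rw [Real.norm_eq_abs] at this
  have h4 := D.norm_e n
  nlinarith [norm_nonneg φ, norm_nonneg (D.e n)]

lemma one_div_mem (n : ℕ) : 0 < 1 / ((n : ℝ) + 2) ∧ 1 / ((n : ℝ) + 2) ≤ 1 := by
  refine ⟨by positivity, ?_⟩
  rw [div_le_one (by positivity)]
  have : (0 : ℝ) ≤ n := n.cast_nonneg
  linarith

lemma abs_apply_uVec_le (D : AdaptedSystem x) (i : ℕ) {y : ℕ → Y} (hy1 : ∀ n, ‖y n‖ = 1)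
    {φ : StrongDual ℝ Y} (hφ : ‖φ‖ ≤ 1) (n : ℕ) : |φ (D.uVec i y n)| ≤ 1 := by
  obtain ⟨h0, h1⟩ := one_div_mem n
  have h2 := abs_le.1 (D.abs_apply_e_le hφ (4 * n + i))
  have h3 := abs_le.1 (abs_apply_le_one hφ (hy1 n).le)
  simp only [uVec, map_add, map_smul, smul_eq_mul]
  set t := 1 / ((n : ℝ) + 2)
  rw [abs_le]
  constructor <;> nlinarith

lemma abs_apply_wVec_le (D : AdaptedSystem x) (hx : ∀ n, ‖x n‖ ≤ 1) (i : ℕ)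
    {φ : StrongDual ℝ Y} (hφ : ‖φ‖ ≤ 1) (n : ℕ) (b : Bool) :
    |φ (D.wVec i n b)| ≤ 51 / 100 := by
  have h2 := abs_le.1 (D.abs_apply_e_le hφ (4 * n + 2 + i))
  have h3 := abs_le.1 (abs_apply_le_one hφ (hx n))
  simp only [wVec, map_add, map_smul, smul_eq_mul]
  rw [abs_le]
  cases b <;> simp only [sign] <;> constructor <;> norm_num <;> linarith

lemma norm_vertex_le (D : AdaptedSystem x) (hx : ∀ n, ‖x n‖ ≤ 1) (i : ℕ) {y : ℕ → Y}
    (hy1 : ∀ n, ‖y n‖ = 1) (q : Bool × (ℕ ⊕ ℕ × Bool)) : ‖D.vertex i y q‖ ≤ 1 := by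
  obtain ⟨φ, hφ, h⟩ := exists_dual_vector'' ℝ (D.vertex i y q)
  have h' : φ (D.vertex i y q) = ‖D.vertex i y q‖ := h
  rw [← h']
  refine (le_abs_self _).trans ?_
  obtain ⟨a, n | ⟨n, b⟩⟩ := q
  · rw [vertex, map_smul, smul_eq_mul, abs_mul, abs_sign, one_mul]
    exact D.abs_apply_uVec_le i hy1 hφ n
  · rw [vertex, map_smul, smul_eq_mul, abs_mul, abs_sign, one_mul]
    exact (D.abs_apply_wVec_le hx i hφ n b).trans (by norm_num)

lemma f_uVec (D : AdaptedSystem x) {i : ℕ} {y : ℕ → Y} (hy : ∀ n, y n ∈ D.rich i)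
    {j : ℕ} (hj : j % 2 = i) (n : ℕ) :
    D.f j (D.uVec i y n) = if j = 4 * n + i then 1 / ((n : ℝ) + 2) / 4 else 0 := by
  simp only [uVec, map_add, map_smul, smul_eq_mul, (D.mem_rich.1 (hy n)).2 j hj, D.f_e]
  split_ifs <;> simp

lemma f_wVec (D : AdaptedSystem x) (i j n : ℕ) (b : Bool) :
    D.f j (D.wVec i n b) =
      (if j = 4 * n + 2 + i then 1 / 8 else 0) + sign b / 100 * D.f j (x n) := by
  simp only [wVec, map_add, map_smul, smul_eq_mul, D.f_e]
  split_ifs <;> simp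

/-- Take `φ` norming `y n`, plus `16` times the functional dual to the tilt. With `t = 1 / (n + 2)`
the value at the vertex is at least `1 - 2t + 4t > 1`. The added term vanishes at the other `uVec`,
and at any `wVec` the total is at most `51/100 + 16/100`. -/
lemma exists_exposing_uVec (D : AdaptedSystem x) (hx : ∀ n, ‖x n‖ ≤ 1) {i : ℕ} (hi : i < 2)
    {y : ℕ → Y} (hy : ∀ n, y n ∈ D.rich i) (hy1 : ∀ n, ‖y n‖ = 1) (n : ℕ) :
    ∃ F : StrongDual ℝ Y, ∃ c : ℝ, 0 ≤ c ∧ c < F (D.uVec i y n) ∧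
      (∀ m, m ≠ n → |F (D.uVec i y m)| ≤ c) ∧ ∀ m b, |F (D.wVec i m b)| ≤ c := by
  obtain ⟨φ, hφ, hφy⟩ := exists_dual_vector'' ℝ (y n)
  have hφy' : φ (y n) = 1 := by
    have : φ (y n) = ‖y n‖ := hφy
    rw [this, hy1]
  have hpar : (4 * n + i) % 2 = i := by omega
  refine ⟨φ + (16 : ℝ) • D.f (4 * n + i), 1, zero_le_one, ?_, fun m hm => ?_, fun m b => ?_⟩
  · rw [add_apply, smul_apply, D.f_uVec hy hpar, if_pos rfl]
    obtain ⟨h0, h1⟩ := one_div_mem n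
    have h2 := abs_le.1 (D.abs_apply_e_le hφ (4 * n + i))
    simp only [uVec, map_add, map_smul, smul_eq_mul, hφy']
    set t := 1 / ((n : ℝ) + 2)
    nlinarith
  · rw [add_apply, smul_apply, D.f_uVec hy hpar, if_neg (by omega), smul_zero, add_zero]
    exact D.abs_apply_uVec_le i hy1 hφ m
  · rw [add_apply, smul_apply, D.f_wVec, if_neg (by omega), zero_add, smul_eq_mul]
    have h1 := D.abs_apply_wVec_le hx i hφ m b
    have h2 := abs_apply_le_one (D.norm_f (4 * n + i)) (hx m)
    refine (abs_add_le _ _).trans ?_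
    rw [abs_mul, abs_mul, abs_div, abs_sign]
    norm_num
    linarith

/-- The functional dual to the tilt gives `1/8` at both `wVec i n b` and `wVec i n (!b)`, since it
kills `x n`. A small multiple of a functional norming `x n` then tells the two apart, with threshold
`c` the value without the `x n` term; the other vertices stay below `12/100 ≤ c`. -/
lemma exists_exposing_wVec (D : AdaptedSystem x) (hx : ∀ n, ‖x n‖ ≤ 1) (hx0 : ∀ n, x n ≠ 0)
    {i : ℕ} (hi : i < 2) {y : ℕ → Y} (hy : ∀ n, y n ∈ D.rich i) (hy1 : ∀ n, ‖y n‖ = 1)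
    (n : ℕ) (b : Bool) :
    ∃ F : StrongDual ℝ Y, ∃ c : ℝ, 0 ≤ c ∧ c < F (D.wVec i n b) ∧
      |F (D.wVec i n (!b))| ≤ c ∧
      (∀ m, m ≠ n → ∀ b', |F (D.wVec i m b')| ≤ c) ∧ ∀ m, |F (D.uVec i y m)| ≤ c := by
  obtain ⟨ψ, hψ, hψx⟩ := exists_dual_vector'' ℝ (x n)
  have hψx' : ψ (x n) = ‖x n‖ := hψx
  have hpar : (4 * n + 2 + i) % 2 = i := by omega
  have hfx : D.f (4 * n + 2 + i) (x n) = 0 :=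
    D.f_zero _ _ (D.mono (by omega) (D.x_mem n))
  have he := abs_le.1 (D.abs_apply_e_le hψ (4 * n + 2 + i))
  have hxpos : 0 < ‖x n‖ := norm_pos_iff.2 (hx0 n)
  have hx1 := hx n
  have hc : 12 / 100 ≤ 1 / 8 + sign b / 800 * ψ (D.e (4 * n + 2 + i)) := by
    cases b <;> simp only [sign] <;> norm_num <;> linarith
  have hψw : ∀ m b', |ψ (D.wVec i m b')| ≤ 51 / 100 := fun m b' =>
    D.abs_apply_wVec_le hx i hψ m b'
  have hval : ∀ b', (D.f (4 * n + 2 + i) + (sign b / 100) • ψ) (D.wVec i n b') =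
      1 / 8 + sign b / 800 * ψ (D.e (4 * n + 2 + i)) + sign b * sign b' / 10000 * ‖x n‖ := by
    intro b'
    rw [add_apply, smul_apply, D.f_wVec, if_pos rfl, hfx, wVec, map_add, map_smul, map_smul, hψx']
    simp only [smul_eq_mul]
    ring
  refine ⟨D.f (4 * n + 2 + i) + (sign b / 100) • ψ,
    1 / 8 + sign b / 800 * ψ (D.e (4 * n + 2 + i)), by linarith, ?_, ?_, fun m hm b' => ?_,
    fun m => ?_⟩
  · rw [hval, show sign b * sign b = 1 by cases b <;> norm_num [sign]]
    linarith
  · rw [hval, show sign b * sign (!b) = -1 by cases b <;> norm_num [sign], abs_le]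
    constructor <;> linarith
  · refine le_trans ?_ hc
    rw [add_apply, smul_apply, D.f_wVec, if_neg (by omega), zero_add, smul_eq_mul]
    have h1 := hψw m b'
    have h2 := abs_apply_le_one (D.norm_f (4 * n + 2 + i)) (hx m)
    refine (abs_add_le _ _).trans ?_
    rw [abs_mul, abs_mul, abs_div, abs_div, abs_sign, abs_sign]
    norm_num
    linarith
  · refine le_trans ?_ hc
    rw [add_apply, smul_apply, D.f_uVec hy hpar, if_neg (by omega), zero_add, smul_eq_mul, abs_mul,
      abs_div, abs_sign]
    have h1 := D.abs_apply_uVec_le i hy1 hψ m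
    norm_num
    linarith

lemma exists_exposing_vertex (D : AdaptedSystem x) (hx : ∀ n, ‖x n‖ ≤ 1) (hx0 : ∀ n, x n ≠ 0)
    {i : ℕ} (hi : i < 2) {y : ℕ → Y} (hy : ∀ n, y n ∈ D.rich i) (hy1 : ∀ n, ‖y n‖ = 1)
    (q : Bool × (ℕ ⊕ ℕ × Bool)) :
    ∃ F : StrongDual ℝ Y, ∃ c : ℝ, F ≠ 0 ∧ c < F (D.vertex i y q) ∧
      ∀ q', c < F (D.vertex i y q') → D.vertex i y q' = D.vertex i y q := by
  -- Bounding absolute values with `c ≥ 0` deals with the reflected vertices as well.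
  have key : ∀ p : ℕ ⊕ ℕ × Bool, ∃ F : StrongDual ℝ Y, ∃ c : ℝ, 0 ≤ c ∧
      c < F (D.vertex i y (true, p)) ∧
      ∀ p', p' ≠ p → |F (D.vertex i y (true, p'))| ≤ c := by
    rintro (n | ⟨n, b⟩)
    · obtain ⟨F, c, hc, h1, h2, h3⟩ := D.exists_exposing_uVec hx hi hy hy1 n
      refine ⟨F, c, hc, by simpa [vertex, sign] using h1, ?_⟩
      rintro (m | ⟨m, b'⟩) hne
      · simpa [vertex, sign] using h2 m fun h => hne (by rw [h])
      · simpa [vertex, sign] using h3 m b'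
    · obtain ⟨F, c, hc, h1, h2, h3, h4⟩ := D.exists_exposing_wVec hx hx0 hi hy hy1 n b
      refine ⟨F, c, hc, by simpa [vertex, sign] using h1, ?_⟩
      rintro (m | ⟨m, b'⟩) hne
      · simpa [vertex, sign] using h4 m
      · by_cases hm : m = n
        · subst hm
          have hb : b' = !b := by
            rw [ne_eq, Sum.inr.injEq, Prod.mk.injEq] at hne
            cases b <;> cases b' <;> simp_all
          simpa [vertex, sign, hb] using h2
        · simpa [vertex, sign] using h3 m hm b'
  obtain ⟨a, p⟩ := q
  obtain ⟨F, c, hc, h1, h2⟩ := key p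
  have hF0 : F ≠ 0 := by
    rintro rfl
    exact absurd h1 (not_lt.2 (by simpa using hc))
  have h3 : ∀ a' p', c < F (D.vertex i y (a', p')) → a' = true ∧ p' = p := by
    intro a' p' h
    have h4 : F (D.vertex i y (false, p')) = -F (D.vertex i y (true, p')) := by
      rw [← map_neg, ← vertex_not]
      rfl
    by_cases hp : p' = p
    · subst hp
      cases a'
      · rw [h4] at h
        linarith
      · exact ⟨rfl, rfl⟩
    · have h5 := abs_le.1 (h2 p' hp)
      cases a'
      · rw [h4] at h
        linarith
      · linarith
  cases a
  · have hneg : ∀ a' p', (-F) (D.vertex i y (a', p')) = F (D.vertex i y (!a', p')) := by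
      intro a' p'
      rw [vertex_not, map_neg, neg_apply]
    refine ⟨-F, c, neg_ne_zero.2 hF0, by rw [hneg]; exact h1, ?_⟩
    rintro ⟨a', p'⟩ h
    rw [hneg] at h
    obtain ⟨h5, rfl⟩ := h3 _ _ h
    cases a'
    · rfl
    · simp at h5
  · refine ⟨F, c, hF0, h1, ?_⟩
    rintro ⟨a', p'⟩ h
    obtain ⟨rfl, rfl⟩ := h3 _ _ h
    rfl

lemma isSCD_body (D : AdaptedSystem x) (hx : ∀ n, ‖x n‖ ≤ 1) (hx0 : ∀ n, x n ≠ 0)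
    {i : ℕ} (hi : i < 2) {y : ℕ → Y} (hy : ∀ n, y n ∈ D.rich i) (hy1 : ∀ n, ‖y n‖ = 1) :
    IsSCD (D.body i y) :=
  isSCD_closure_convexHull (D.norm_vertex_le hx i hy1)
    (D.exists_exposing_vertex hx hx0 hi hy hy1)

lemma vertex_mem_body (D : AdaptedSystem x) (i : ℕ) (y : ℕ → Y) (q : Bool × (ℕ ⊕ ℕ × Bool)) :
    D.vertex i y q ∈ D.body i y :=
  subset_closure (subset_convexHull ℝ _ ⟨q, rfl⟩)

lemma convex_body (D : AdaptedSystem x) (i : ℕ) (y : ℕ → Y) : Convex ℝ (D.body i y) :=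
  (convex_convexHull ℝ _).closure

lemma isClosed_body (D : AdaptedSystem x) (i : ℕ) (y : ℕ → Y) : IsClosed (D.body i y) :=
  isClosed_closure

lemma zero_mem_body (D : AdaptedSystem x) (i : ℕ) (y : ℕ → Y) : (0 : Y) ∈ D.body i y := by
  have h1 := D.vertex_mem_body i y (true, Sum.inl 0)
  have h2 := D.vertex_mem_body i y (!true, Sum.inl 0)
  have := D.convex_body i y h1 h2 (a := 1 / 2) (b := 1 / 2) (by norm_num) (by norm_num)
    (by norm_num)
  rwa [vertex_not, smul_neg, add_neg_cancel] at this

lemma rich_subset_body (D : AdaptedSystem x) (i : ℕ) {y : ℕ → Y} (hy1 : ∀ n, ‖y n‖ = 1)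
    (hyd : ∀ z ∈ D.rich i, ‖z‖ = 1 → ∀ ε : ℝ, 0 < ε → ∀ N, ∃ n, N ≤ n ∧ ‖z - y n‖ < ε)
    {z : Y} (hz : z ∈ D.rich i) (hz1 : ‖z‖ ≤ 1) : z ∈ D.body i y := by
  have hunit : ∀ z ∈ D.rich i, ‖z‖ = 1 → z ∈ D.body i y := by
    intro z hz hz1
    rw [← (D.isClosed_body i y).closure_eq, Metric.mem_closure_iff]
    intro ε hε
    obtain ⟨N, hN⟩ := exists_nat_gt (4 / ε)
    obtain ⟨n, hn, hd⟩ := hyd z hz hz1 (ε / 2) (by positivity) N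
    refine ⟨D.uVec i y n, by simpa [vertex, sign] using D.vertex_mem_body i y (true, Sum.inl n), ?_⟩
    have hn' : (N : ℝ) ≤ n := by exact_mod_cast hn
    have ht : 1 / ((n : ℝ) + 2) < ε / 4 := by
      rw [div_lt_iff₀ (by positivity)]
      rw [div_lt_iff₀ hε] at hN
      nlinarith
    have ht0 := (one_div_mem n).1
    have e1 : z - D.uVec i y n = (z - y n) + (1 / ((n : ℝ) + 2)) • (y n - (1 / 4 : ℝ) •
        D.e (4 * n + i)) := by
      rw [uVec]
      module
    have h5 : ‖y n - (1 / 4 : ℝ) • D.e (4 * n + i)‖ ≤ 2 := by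
      refine (norm_sub_le _ _).trans ?_
      rw [hy1, norm_smul, Real.norm_of_nonneg (by norm_num)]
      linarith [D.norm_e (4 * n + i)]
    rw [dist_eq_norm, e1]
    refine (norm_add_le _ _).trans_lt ?_
    rw [norm_smul, Real.norm_of_nonneg ht0.le]
    nlinarith
  by_cases h0 : z = 0
  · rw [h0]
    exact D.zero_mem_body i y
  · have hn : 0 < ‖z‖ := norm_pos_iff.2 h0
    have h1 := hunit (‖z‖⁻¹ • z) (Submodule.smul_mem _ _ hz) (norm_smul_inv_norm h0)
    have h2 := ((D.convex_body i y).starConvex (D.zero_mem_body i y)).smul_mem h1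
      hn.le hz1
    rwa [smul_smul, mul_inv_cancel₀ hn.ne', one_smul] at h2

/-- The midpoint of `wVec i n true` and `-wVec i n false` is `x n / 100`: the tilts cancel. -/
lemma ball_subset_body (D : AdaptedSystem x) (i : ℕ) (y : ℕ → Y)
    (hxd : ∀ z, z ≠ 0 → ‖z‖ < 1 → z ∈ closure (Set.range x)) :
    Metric.closedBall (0 : Y) (1 / 200) ⊆ D.body i y := by
  intro z hz
  by_cases h0 : z = 0
  · rw [h0]
    exact D.zero_mem_body i y
  have hz' : ‖z‖ ≤ 1 / 200 := by simpa using hz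
  have h1 : (100 : ℝ) • z ∈ closure (Set.range x) := by
    refine hxd _ (smul_ne_zero (by norm_num) h0) ?_
    rw [norm_smul, Real.norm_of_nonneg (by norm_num)]
    linarith
  have h2 : Set.MapsTo (fun w : Y => (1 / 100 : ℝ) • w) (Set.range x) (D.body i y) := by
    rintro _ ⟨n, rfl⟩
    have h3 := D.vertex_mem_body i y (true, Sum.inr (n, true))
    have h4 := D.vertex_mem_body i y (false, Sum.inr (n, false))
    have h5 := D.convex_body i y h3 h4 (a := 1 / 2) (b := 1 / 2) (by norm_num) (by norm_num)
      (by norm_num)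
    convert h5 using 1
    simp only [vertex, wVec, sign, if_true, Bool.false_eq_true, if_false]
    module
  have h6 := h2.closure (by fun_prop) h1
  rw [(D.isClosed_body i y).closure_eq] at h6
  simpa [smul_smul] using h6

/-- The vertices are dominated, in every direction, by the unit balls of the two rich subspaces. -/
lemma exists_rich_ge (D : AdaptedSystem x) (hx : ∀ n, ‖x n‖ ≤ 1) {i : ℕ} (hi : i < 2) {y : ℕ → Y}
    (hy : ∀ n, y n ∈ D.rich i) (hy1 : ∀ n, ‖y n‖ = 1) (q : Bool × (ℕ ⊕ ℕ × Bool))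
    (h : StrongDual ℝ Y) :
    ∃ j < 2, ∃ z ∈ D.rich j, ‖z‖ ≤ 1 ∧ h (D.vertex i y q) ≤ h z := by
  set T : Set Y := {z | ∃ j < 2, z ∈ D.rich j ∧ ‖z‖ ≤ 1} with hT
  have hC : Convex ℝ (convexHull ℝ T) := convex_convexHull ℝ T
  have hTC : ∀ z ∈ T, z ∈ convexHull ℝ T := fun z hz => subset_convexHull ℝ T hz
  -- A tilt of parity `i` belongs to the ball of the opposite rich subspace.
  have he : ∀ n, n % 2 = i → (1 / 4 : ℝ) • D.e n ∈ T := by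
    intro n hn
    refine ⟨1 - i, by omega, Submodule.smul_mem _ _ (D.e_mem_rich (by omega)), ?_⟩
    rw [norm_smul, Real.norm_of_nonneg (by norm_num)]
    linarith [D.norm_e n]
  have hu : ∀ n, D.uVec i y n ∈ convexHull ℝ T := by
    intro n
    obtain ⟨h0, h1⟩ := one_div_mem n
    have h2 := hC (hTC _ ⟨i, hi, hy n, (hy1 n).le⟩) (hTC _ (he (4 * n + i) (by omega)))
      (sub_nonneg.2 h1) h0.le (by ring)
    convert h2 using 1
    rw [uVec, smul_smul]
    congr 2
    ring
  -- Half of `e / 4`, plus a quarter each of `± v / 25` and `± (x - v) / 25`, whose norms are at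
  -- most `4/25` and `5/25`.
  have hw : ∀ n b, D.wVec i n b ∈ convexHull ℝ T := by
    intro n b
    have hs : ‖sign b / 25‖ = 1 / 25 := by rw [Real.norm_eq_abs, abs_div, abs_sign]; norm_num
    have hv : (sign b / 25) • D.v n ∈ T := by
      refine ⟨1, by norm_num, Submodule.smul_mem _ _ (D.v_mem_rich n), ?_⟩
      rw [norm_smul, hs]
      linarith [D.norm_v n]
    have hxv : (sign b / 25) • (x n - D.v n) ∈ T := by
      refine ⟨0, by norm_num, Submodule.smul_mem _ _ (D.sub_v_mem_rich n), ?_⟩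
      rw [norm_smul, hs]
      linarith [D.norm_v n, norm_sub_le (x n) (D.v n), hx n]
    have h2 := hC (hTC _ hv) (hTC _ hxv) (a := 1 / 2) (b := 1 / 2) (by norm_num) (by norm_num)
      (by norm_num)
    have h3 := hC (hTC _ (he (4 * n + 2 + i) (by omega))) h2 (a := 1 / 2) (b := 1 / 2)
      (by norm_num) (by norm_num) (by norm_num)
    convert h3 using 1
    rw [wVec]
    module
  have hneg : ∀ z ∈ T, -z ∈ T := by
    rintro z ⟨j, hj, hz, hz1⟩
    exact ⟨j, hj, Submodule.neg_mem _ hz, by rwa [norm_neg]⟩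
  have key : ∀ z ∈ convexHull ℝ T, ∀ a, ∃ w ∈ T, h (sign a • z) ≤ h w := by
    intro z hz a
    cases a
    · obtain ⟨w, hw, hle⟩ := exists_le_of_mem_convexHull hz (-h)
      refine ⟨-w, hneg w hw, ?_⟩
      simpa [sign] using hle
    · obtain ⟨w, hw, hle⟩ := exists_le_of_mem_convexHull hz h
      exact ⟨w, hw, by simpa [sign] using hle⟩
  obtain ⟨a, n | ⟨n, b⟩⟩ := q
  · obtain ⟨w, ⟨j, hj, hwj, hw1⟩, hle⟩ := key _ (hu n) a
    exact ⟨j, hj, w, hwj, hw1, hle⟩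
  · obtain ⟨w, ⟨j, hj, hwj, hw1⟩, hle⟩ := key _ (hw n b) a
    exact ⟨j, hj, w, hwj, hw1, hle⟩

/-- A slice contains a vertex, hence a point of the ball of some `D.rich j`, with `j` possibly
different from the parity of the vertex's body. `approx` replaces it by an almost orthogonal point
of the same ball, which is in the union because body `j` is. -/
lemma not_isSCD_union (D : AdaptedSystem x) (hx : ∀ n, ‖x n‖ ≤ 1) {y : ℕ → ℕ → Y}
    (hy : ∀ i < 2, ∀ n, y i n ∈ D.rich i) (hy1 : ∀ i < 2, ∀ n, ‖y i n‖ = 1)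
    (hyd : ∀ i < 2, ∀ z ∈ D.rich i, ‖z‖ = 1 → ∀ ε : ℝ, 0 < ε → ∀ N, ∃ n, N ≤ n ∧ ‖z - y i n‖ < ε) :
    ¬ IsSCD (D.body 0 (y 0) ∪ D.body 1 (y 1)) := by
  have hbody : ∀ z, z ∈ D.body 0 (y 0) ∪ D.body 1 (y 1) ↔ ∃ i < 2, z ∈ D.body i (y i) := by
    intro z
    constructor
    · rintro (h | h)
      · exact ⟨0, by norm_num, h⟩
      · exact ⟨1, by norm_num, h⟩
    · rintro ⟨i, hi, h⟩
      interval_cases i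
      · exact Or.inl h
      · exact Or.inr h
  have hsub : ∀ i < 2, ∀ z ∈ D.rich i, ‖z‖ ≤ 1 → z ∈ D.body 0 (y 0) ∪ D.body 1 (y 1) :=
    fun i hi z hz hz1 => (hbody z).2 ⟨i, hi, D.rich_subset_body i (hy1 i hi) (hyd i hi) hz hz1⟩
  obtain ⟨z₀, hz₀, hz₀1⟩ := D.exists_unit_mem_rich (i := 0) (by norm_num)
  obtain ⟨k₀, hk₀⟩ := (D.mem_rich.1 hz₀).1
  refine not_isSCD_of_almostL1Orth D.mono (hsub 0 (by norm_num) z₀ hz₀ hz₀1.le) hk₀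
    (by rintro rfl; simp at hz₀1) ?_
  rintro S ⟨⟨s, hs⟩, h, -, η, hη, rfl⟩ k ε hε
  obtain ⟨hsU, hsh⟩ := hs
  obtain ⟨i, hi, hsi⟩ := (hbody s).1 hsU
  obtain ⟨_, ⟨q, rfl⟩, hq⟩ := exists_lt_of_mem_closure_convexHull hsi h hsh
  obtain ⟨j, hj, z, hz, hz1, hqz⟩ := D.exists_rich_ge hx hi (hy i hi) (hy1 i hi) q h
  have hlt := hq.trans_le hqz
  obtain ⟨⟨k', hk'⟩, hzf⟩ := D.mem_rich.1 hz
  -- The tolerance is also capped by the margin of `h z` above the slice level, so that `w` stays in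
  -- the slice.
  obtain ⟨m, w, hwG, hw1, hwf, hwO, hw⟩ := D.approx j hj (max k k')
    z (D.mono (le_max_right _ _) hk') hz1 hzf h (min ε (h z - _)) (lt_min hε (sub_pos.2 hlt))
  refine ⟨m, w, hwG, ⟨hsub j hj w (D.mem_rich.2 ⟨⟨m, hwG⟩, hwf⟩) hw1, ?_⟩,
    hwO.mono (D.mono (le_max_left _ _)) (min_le_left _ _)⟩
  have := min_le_right ε (h z - (sSup (h '' (D.body 0 (y 0) ∪ D.body 1 (y 1))) - η))
  linarith

end AdaptedSystem

/-! ### Assembling the theorem. -/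

section Main

variable {Y : Type*} [NormedAddCommGroup Y] [NormedSpace ℝ Y]

/-- In a space with the Daugavet property, every sequence of non-zero vectors of the unit ball gives
two slicely countably determined bodies whose union is not slicely countably determined; if the
sequence is dense in the ball, then the bodies contain a ball around `0`. -/
theorem exists_bodies [Nontrivial Y] (hY : DaugavetProperty Y) (x : ℕ → Y) (hx : ∀ n, ‖x n‖ ≤ 1)
    (hx0 : ∀ n, x n ≠ 0) :
    ∃ B : ℕ → Set Y,
      (∀ i < 2, (Convex ℝ (B i) ∧ IsClosed (B i) ∧ Bornology.IsBounded (B i) ∧ -B i = B i ∧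
        IsSCD (B i)) ∧ ((∀ z, z ≠ 0 → ‖z‖ < 1 → z ∈ closure (Set.range x)) →
          Metric.closedBall (0 : Y) (1 / 200) ⊆ B i)) ∧
      ¬ IsSCD (B 0 ∪ B 1) := by
  obtain ⟨D⟩ := exists_adaptedSystem hY x hx
  have hy := fun i (hi : i < 2) => D.exists_dense_seq hi
  choose! y hy using hy
  have hscd : ∀ i < 2, IsSCD (D.body i (y i)) := fun i hi =>
    D.isSCD_body hx hx0 hi (fun n => ((hy i hi).1 n).1) fun n => ((hy i hi).1 n).2
  refine ⟨fun i => D.body i (y i), fun i hi => ⟨⟨D.convex_body i _, D.isClosed_body i _,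
    (hscd i hi).1, D.body_symm i _, hscd i hi⟩, D.ball_subset_body i _⟩,
    D.not_isSCD_union hx (fun i hi n => ((hy i hi).1 n).1) (fun i hi n => ((hy i hi).1 n).2)
      fun i hi => (hy i hi).2⟩

lemma exists_seq_dense_ball [Nontrivial Y] [TopologicalSpace.SeparableSpace Y] :
    ∃ x : ℕ → Y, (∀ n, ‖x n‖ ≤ 1) ∧ (∀ n, x n ≠ 0) ∧
      ∀ z, z ≠ 0 → ‖z‖ < 1 → z ∈ closure (Set.range x) := by
  set S : Set Y := {z | z ≠ 0 ∧ ‖z‖ ≤ 1} with hS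
  have := (TopologicalSpace.IsSeparable.of_separableSpace S).separableSpace
  obtain ⟨u, hu⟩ := exists_norm_eq Y zero_le_one
  have : Nonempty S := ⟨⟨u, by rintro rfl; simp at hu, hu.le⟩⟩
  refine ⟨fun n => TopologicalSpace.denseSeq S n, fun n => (Subtype.coe_prop
    (TopologicalSpace.denseSeq S n)).2, fun n => (Subtype.coe_prop
    (TopologicalSpace.denseSeq S n)).1, fun z hz hz1 => ?_⟩
  rw [Metric.mem_closure_range_iff]
  intro ε hε
  exact (TopologicalSpace.denseRange_denseSeq S).exists_dist_lt ⟨z, hz, hz1.le⟩ hε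

end Main

end BanachSCD

theorem mainTheorem6 {Y : Type*} [NormedAddCommGroup Y] [NormedSpace ℝ Y] [CompleteSpace Y]
    [Nontrivial Y] (hY : BanachSCD.DaugavetProperty Y) :
    (∃ B₁ B₂ : Set Y,
      (Convex ℝ B₁ ∧ IsClosed B₁ ∧ Bornology.IsBounded B₁ ∧ -B₁ = B₁ ∧ BanachSCD.IsSCD B₁) ∧
      (Convex ℝ B₂ ∧ IsClosed B₂ ∧ Bornology.IsBounded B₂ ∧ -B₂ = B₂ ∧ BanachSCD.IsSCD B₂) ∧
      ¬ BanachSCD.IsSCD (B₁ ∪ B₂)) ∧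
    (TopologicalSpace.SeparableSpace Y →
      ∃ B₁ B₂ : Set Y,
        (Convex ℝ B₁ ∧ IsClosed B₁ ∧ Bornology.IsBounded B₁ ∧ -B₁ = B₁ ∧ BanachSCD.IsSCD B₁) ∧
        (Convex ℝ B₂ ∧ IsClosed B₂ ∧ Bornology.IsBounded B₂ ∧ -B₂ = B₂ ∧ BanachSCD.IsSCD B₂) ∧
        ((interior B₁).Nonempty ∧ BanachSCD.IsEquivNormUnitBall B₁) ∧
        ((interior B₂).Nonempty ∧ BanachSCD.IsEquivNormUnitBall B₂) ∧
        ¬ BanachSCD.IsSCD (B₁ ∪ B₂)) := by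
  constructor
  · obtain ⟨u, hu⟩ := exists_norm_eq Y zero_le_one
    -- Without an interior to produce, a constant sequence serves as `x`.
    obtain ⟨B, hB, hU⟩ := BanachSCD.exists_bodies hY (fun _ => u) (fun _ => hu.le)
      (fun _ => by rintro rfl; simp at hu)
    exact ⟨B 0, B 1, (hB 0 (by norm_num)).1, (hB 1 (by norm_num)).1, hU⟩
  · intro hsep
    obtain ⟨x, hx, hx0, hxd⟩ := BanachSCD.exists_seq_dense_ball (Y := Y)
    obtain ⟨B, hB, hU⟩ := BanachSCD.exists_bodies hY x hx hx0
    have hball : ∀ i < 2, (interior (B i)).Nonempty ∧ BanachSCD.IsEquivNormUnitBall (B i) := by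
      intro i hi
      obtain ⟨⟨h1, h2, h3, h4, -⟩, h5⟩ := hB i hi
      refine ⟨⟨0, mem_interior_iff_mem_nhds.2 (Filter.mem_of_superset
        (Metric.closedBall_mem_nhds 0 (by norm_num)) (h5 hxd))⟩, ?_⟩
      exact BanachSCD.isEquivNormUnitBall_of_closedBall_subset h1 h2 h3 h4 (by norm_num) (h5 hxd)
    exact ⟨B 0, B 1, (hB 0 (by norm_num)).1, (hB 1 (by norm_num)).1, hball 0 (by norm_num),
      hball 1 (by norm_num), hU⟩
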